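/- For $n\in\mathbb N$ and $a>0$ let $$\mathbb P(a,n)=\frac{\frac1{n!}\int_{\mathbb R^n}\prod_{1\le i<j\le n}(x_j-x_i)^2\prod_{k=1}^n e^{-x_k^2}\bigl(1-\chi_{(-a,a)}(x_k)\bigr)\,dx}{\frac1{n!}\int_{\mathbb R^n}\prod_{1\le i<j\le n}(x_j-x_i)^2\prod_{k=1}^n e^{-x_k^2}\,dx}$$ be the probability that $(-a,a)$ contains no eigenvalue of the $n\times n$ Gaussian unitary ensemble with weight $e^{-x^2}$. Then $\mathbb P(a,n)>0$ and $\mathbb P(\cdot,n)$ is differentiable on $(0,\infty)$, so that $\sigma_n(a):=a\,\frac{d}{da}\log\mathbb P(a,n)$ is well defined for $a>0$. For every $\tau>0$ the double scaling limit, in which $\tau=2\sqrt{2n}\,a$ is fixed, $$\sigma(\tau):=\lim_{n\to\infty}\sigma_n\!\left(\frac{\tau}{2\sqrt{2n}}\right)$$ exists, $\sigma$ is twice continuously differentiable on $(0,\infty)$, and $$(\tau\sigma'')^2=-4\bigl(\sigma-\tau\sigma'-(\sigma')^2\bigr)\bigl(\sigma-\tau\sigma'\bigr)\qquad(\tau>0),\tag{1}$$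 which is equation (7.104) of Jimbo, Miwa, Môri and Sato. Moreover, the change of variable $\tau\to\frac i2\tau$ converts (1) into the $\sigma$-form of Painlevé V, $$(t s'')^2=\Bigl(s-ts'+2(s')^2+(\nu_0+\nu_1+\nu_2+\nu_3)s'\Bigr)^2-4(\nu_0+s')(\nu_1+s')(\nu_2+s')(\nu_3+s'),\tag{2}$$ with $\nu_0=\nu_1=\nu_2=\nu_3=0$: for every open $U\subseteq\mathbb C$, a function $f$ on $U$ is a holomorphic solution of (1) on $U$ if and only if $s(t)=f(it/2)$ is a holomorphic solution of (2) with zero parameters on $\{t\in\mathbb C: it/2\in U\}$. Furthermore, $\sigma$ extends to a holomorphic solution of (1) on some connected open set $U\subseteq\mathbb C$ containing $(0,\infty)$, and for this extension $s(t)=\sigma(it/2)$ satisfies (2) with zero parameters on $\{t: it/2\in U\}$. -/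

import Mathlib

open Filter Topology MeasureTheory Set

/-- The partition function `D_n = (1/n!) ∫_{ℝⁿ} ∏_{i<j} (x_j - x_i)² ∏_k w(x_k) dx` of the unitary
ensemble of `n` particles on the line with weight `w`. -/
noncomputable def unitaryPartition (n : ℕ) (w : ℝ → ℝ) : ℝ :=
  ((n.factorial : ℝ))⁻¹ *
    ∫ x : Fin n → ℝ, (∏ i : Fin n, ∏ j ∈ Finset.Ioi i, (x j - x i) ^ 2) * ∏ k : Fin n, w (x k)

/-- The Gaussian weight `w₀(x) = e^{-x²}`. -/
noncomputable def gueWeight (x : ℝ) : ℝ := Real.exp (-x ^ 2)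

/-- The gap weight `w(x,a) = e^{-x²} (1 - χ_{(-a,a)}(x))`. -/
noncomputable def gueGapWeight (a x : ℝ) : ℝ :=
  gueWeight x * (1 - (Ioo (-a) a).indicator (fun _ => (1 : ℝ)) x)

/-- `ℙ(a,n)`: the probability that `(-a,a)` contains no eigenvalue of the `n × n` Gaussian unitary
ensemble, whose eigenvalue density is proportional to `∏_{i<j} (x_j - x_i)² ∏_k e^{-x_k²}`. -/
noncomputable def gueGapProb (a : ℝ) (n : ℕ) : ℝ :=
  unitaryPartition n (gueGapWeight a) / unitaryPartition n gueWeight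

/-- `σ_n(a) = a · d/da log ℙ(a,n)`. -/
noncomputable def gueSigma (n : ℕ) (a : ℝ) : ℝ :=
  a * deriv (fun b : ℝ => Real.log (gueGapProb b n)) a

/-- `σ` is a solution on `U` of `(τσ'')² = -4 (σ - τσ' - (σ')²)(σ - τσ')`. It is used with `U` open,
for `𝕜 = ℝ`, and for `𝕜 = ℂ`, where the regularity condition says that `σ` is holomorphic on `U`. -/
def IsJMMSSolution {𝕜 : Type*} [NontriviallyNormedField 𝕜] (U : Set 𝕜) (σ : 𝕜 → 𝕜) : Prop :=
  ContDiffOn 𝕜 2 σ U ∧ ∀ τ ∈ U,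
    (τ * deriv (deriv σ) τ) ^ 2 =
      -4 * (σ τ - τ * deriv σ τ - deriv σ τ ^ 2) * (σ τ - τ * deriv σ τ)

/-- `σ` is a solution on `U` of the Jimbo-Miwa-Okamoto `σ`-form of Painlevé V with parameters
`ν₀, ν₁, ν₂, ν₃`:
`(tσ'')² = (σ - tσ' + 2(σ')² + (ν₀+ν₁+ν₂+ν₃)σ')² - 4 (ν₀+σ')(ν₁+σ')(ν₂+σ')(ν₃+σ')`. -/
def IsSigmaPVSolution {𝕜 : Type*} [NontriviallyNormedField 𝕜] (ν : Fin 4 → 𝕜)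
    (U : Set 𝕜) (σ : 𝕜 → 𝕜) : Prop :=
  ContDiffOn 𝕜 2 σ U ∧ ∀ t ∈ U,
    (t * deriv (deriv σ) t) ^ 2 =
      (σ t - t * deriv σ t + 2 * deriv σ t ^ 2 + (∑ i, ν i) * deriv σ t) ^ 2
        - 4 * ∏ i, (ν i + deriv σ t)

/-! By Andréief's identity the gap probability is det(1 - G), where G is the Gram matrix of the
first n Hermite functions on (-a, a). Writing its entries through primitives makes the determinant
`gapDet` entire in a, so the analysis takes place over ℂ.

Let n = m + 1 and N = (1 - G)⁻¹. The logarithmic derivative of the determinant is -2R, where R =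
`gapR` is the bilinear form of N at the vector of Hermite functions. The lowering operator commutes
with G up to rank three (`lowering_commutator`), hence also with N (`gapForm_lowering`). This gives
algebraic relations between R, S = `gapS` and four auxiliary quantities P, Q, Ω, Υ coming from the
edge of the truncation. Eliminating these leaves two differential equations for R and S alone, at
every n: `hasDerivAt_gapR` and `gapS_deriv_relation`.

In the variable t = √(2n) z the equations depend on n only through η = (-1)^m/(m+1), which tends to
0. Asymptotics of the Hermite functions are needed only at the origin: the equations determine all
Taylor coefficients of R and S at 0 recursively from R(0), and the scaled R(0) tends to 1/π by
Wallis' product. So the Taylor coefficients of the scaled determinants converge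
(`coeffsConverge_scaledDet`). Since these determinants are bounded on discs uniformly in n
(`exists_norm_gapDet_le`), they converge locally uniformly to an entire function F. Gap
probabilities decrease with the gap and F(0) = 1, so F has no zero on (0, ∞) (`limit_ne_zero`).

Eliminating S in the limit gives one equation for R = -F'/(2F) off the zeros of F. Under σ(τ) = -τ
R(τ/2) it becomes the required equation, and the Painlevé form follows by algebra from (i/2)² =
-1/4. -/

/-! ### Hermite functions on the complex plane -/

/-- The monic Hermite polynomials for the weight `e^{-x²}`. -/
noncomputable def monicHermite : ℕ → Polynomial ℂ
  | 0 => 1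
  | n + 1 => Polynomial.X * monicHermite n
      - Polynomial.C (1 / 2) * Polynomial.derivative (monicHermite n)

theorem derivative_monicHermite_succ (n : ℕ) :
    Polynomial.derivative (monicHermite (n + 1)) = ((n : Polynomial ℂ) + 1) * monicHermite n := by
  induction n with
  | zero => simp [monicHermite]
  | succ n ih =>
    rw [monicHermite]
    simp only [Polynomial.derivative_sub, Polynomial.derivative_mul, Polynomial.derivative_X,
      Polynomial.derivative_C, ih]
    have h : Polynomial.derivative ((n : Polynomial ℂ) + 1) = 0 := by simp
    rw [h]
    conv_rhs => rw [monicHermite]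
    push_cast
    rw [monicHermite]
    ring

theorem natDegree_monicHermite_and_monic (n : ℕ) :
    (monicHermite n).natDegree = n ∧ (monicHermite n).Monic := by
  induction n with
  | zero => simp [monicHermite]
  | succ n ih =>
    have hX : (Polynomial.X * monicHermite n).degree = ((n + 1 : ℕ) : WithBot ℕ) := by
      rw [Polynomial.degree_mul, Polynomial.degree_X, Polynomial.degree_eq_natDegree ih.2.ne_zero,
        ih.1]
      push_cast
      ring
    have hD : (Polynomial.C (1 / 2) * Polynomial.derivative (monicHermite n)).degree
        < (Polynomial.X * monicHermite n).degree := by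
      rw [Polynomial.degree_C_mul (by norm_num)]
      refine lt_of_le_of_lt Polynomial.degree_derivative_le ?_
      rw [hX, Polynomial.degree_eq_natDegree ih.2.ne_zero, ih.1]
      exact_mod_cast Nat.lt_succ_self n
    have hdeg : (monicHermite (n + 1)).degree = ((n + 1 : ℕ) : WithBot ℕ) := by
      rw [monicHermite, Polynomial.degree_sub_eq_left_of_degree_lt hD, hX]
    refine ⟨Polynomial.natDegree_eq_of_degree_eq_some hdeg, ?_⟩
    rw [monicHermite]
    exact (Polynomial.monic_X.mul ih.2).sub_of_left hD

/-- The normalisation constants of the Hermite functions. -/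
noncomputable def hermiteConst : ℕ → ℝ
  | 0 => (√(√Real.pi))⁻¹
  | n + 1 => hermiteConst n * √(2 / (n + 1))

theorem hermiteConst_pos (n : ℕ) : 0 < hermiteConst n := by
  induction n with
  | zero => rw [hermiteConst]; have := Real.pi_pos; positivity
  | succ n ih => rw [hermiteConst]; positivity

/-- The ladder coefficient `√(2n)`. -/
noncomputable def ladder (n : ℕ) : ℂ := ((√(2 * (n : ℝ)) : ℝ) : ℂ)

theorem ladder_sq (n : ℕ) : ladder n ^ 2 = 2 * n := by
  rw [ladder, ← Complex.ofReal_pow, Real.sq_sqrt (by positivity)]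
  push_cast
  ring

@[simp] theorem ladder_zero : ladder 0 = 0 := by simp [ladder]

theorem ladder_succ_ne_zero (n : ℕ) : ladder (n + 1) ≠ 0 := by
  intro h
  have := ladder_sq (n + 1)
  rw [h] at this
  have h2 : (2 : ℂ) * ((n + 1 : ℕ) : ℂ) ≠ 0 := by
    have : ((n + 1 : ℕ) : ℂ) ≠ 0 := Nat.cast_ne_zero.mpr n.succ_ne_zero
    simp only [ne_eq, mul_eq_zero, OfNat.ofNat_ne_zero, this, or_self, not_false_eq_true]
  exact h2 (by rw [← this]; simp)

theorem hermiteConst_succ_mul_ladder (n : ℕ) :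
    (hermiteConst (n + 1) : ℂ) * ladder (n + 1) = 2 * hermiteConst n := by
  rw [ladder, ← Complex.ofReal_mul, hermiteConst, mul_assoc, ← Real.sqrt_mul (by positivity)]
  have : 2 / ((n : ℝ) + 1) * (2 * ((n + 1 : ℕ) : ℝ)) = 2 ^ 2 := by
    push_cast
    field_simp
  rw [this, Real.sqrt_sq (by norm_num)]
  push_cast
  ring

theorem hermiteConst_mul_ladder_succ (n : ℕ) :
    (hermiteConst n : ℂ) * ladder (n + 1) = (n + 1) * hermiteConst (n + 1) := by
  have h := hermiteConst_succ_mul_ladder n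
  have hs := ladder_sq (n + 1)
  push_cast at hs
  have : (hermiteConst n : ℂ) = hermiteConst (n + 1) * ladder (n + 1) / 2 := by rw [h]; ring
  rw [this]
  linear_combination (hermiteConst (n + 1) : ℂ) / 2 * hs

/-- The Hermite functions, orthonormal on the real line. -/
noncomputable def hermiteFn (n : ℕ) (z : ℂ) : ℂ :=
  hermiteConst n * (monicHermite n).eval z * Complex.exp (-z ^ 2 / 2)

theorem hasDerivAt_gaussian_half (z : ℂ) :
    HasDerivAt (fun z : ℂ => Complex.exp (-z ^ 2 / 2)) (-z * Complex.exp (-z ^ 2 / 2)) z := by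
  have h : HasDerivAt (fun z : ℂ => -z ^ 2 / 2) (-z) z := by
    have := ((hasDerivAt_pow 2 z).neg).div_const 2
    refine this.congr_deriv ?_
    norm_num
    ring
  exact h.cexp.congr_deriv (by ring)

theorem hasDerivAt_hermiteFn_aux (n : ℕ) (z : ℂ) :
    HasDerivAt (hermiteFn n)
      (hermiteConst n * (monicHermite n).derivative.eval z * Complex.exp (-z ^ 2 / 2)
        - z * hermiteFn n z) z := by
  have h := (((monicHermite n).hasDerivAt z).const_mul (hermiteConst n : ℂ)).mul
    (hasDerivAt_gaussian_half z)
  refine h.congr_deriv ?_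
  rw [hermiteFn]
  ring

/-- At n = 0 the truncated index n - 1 is again 0, which is harmless because `ladder 0 = 0`. -/
theorem hasDerivAt_hermiteFn_lower (n : ℕ) (z : ℂ) :
    HasDerivAt (hermiteFn n) (-z * hermiteFn n z + ladder n * hermiteFn (n - 1) z) z := by
  refine (hasDerivAt_hermiteFn_aux n z).congr_deriv ?_
  cases n with
  | zero => simp [monicHermite]
  | succ n =>
    rw [derivative_monicHermite_succ, Nat.add_sub_cancel, hermiteFn, hermiteFn]
    simp only [Polynomial.eval_mul, Polynomial.eval_add, Polynomial.eval_natCast,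
      Polynomial.eval_one]
    linear_combination -((monicHermite n).eval z * Complex.exp (-z ^ 2 / 2))
      * hermiteConst_mul_ladder_succ n

theorem hasDerivAt_hermiteFn_raise (n : ℕ) (z : ℂ) :
    HasDerivAt (hermiteFn n) (z * hermiteFn n z - ladder (n + 1) * hermiteFn (n + 1) z) z := by
  refine (hasDerivAt_hermiteFn_aux n z).congr_deriv ?_
  rw [hermiteFn, hermiteFn, monicHermite]
  simp only [Polynomial.eval_mul, Polynomial.eval_sub, Polynomial.eval_X, Polynomial.eval_C]
  linear_combination (z * (monicHermite n).eval z - 1 / 2 * (monicHermite n).derivative.eval z)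
    * Complex.exp (-z ^ 2 / 2) * hermiteConst_succ_mul_ladder n

theorem differentiable_hermiteFn (n : ℕ) : Differentiable ℂ (hermiteFn n) :=
  fun z => (hasDerivAt_hermiteFn_lower n z).differentiableAt

theorem hermiteFn_raise_eq_lower (n : ℕ) (z : ℂ) :
    z * hermiteFn n z - ladder (n + 1) * hermiteFn (n + 1) z
      = -z * hermiteFn n z + ladder n * hermiteFn (n - 1) z :=
  (hasDerivAt_hermiteFn_raise n z).unique (hasDerivAt_hermiteFn_lower n z)

theorem monicHermite_eval_neg (n : ℕ) (z : ℂ) :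
    (monicHermite n).eval (-z) = (-1) ^ n * (monicHermite n).eval z := by
  induction n using Nat.strong_induction_on with
  | _ n ih =>
    match n with
    | 0 => simp [monicHermite]
    | 1 => simp [monicHermite]
    | n + 2 =>
      rw [monicHermite, derivative_monicHermite_succ]
      simp only [Polynomial.eval_mul, Polynomial.eval_sub, Polynomial.eval_X, Polynomial.eval_C,
        ih (n + 1) (by omega), ih n (by omega), Polynomial.eval_add, Polynomial.eval_natCast,
        Polynomial.eval_one]
      ring

theorem hermiteFn_neg (n : ℕ) (z : ℂ) : hermiteFn n (-z) = (-1) ^ n * hermiteFn n z := by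
  rw [hermiteFn, hermiteFn, monicHermite_eval_neg, neg_sq]
  ring

/-! ### Orthonormality -/

theorem integrable_polynomial_mul_gaussian (q : Polynomial ℂ) :
    Integrable (fun x : ℝ => q.eval (x : ℂ) * Complex.exp (-(x : ℂ) ^ 2)) := by
  induction q using Polynomial.induction_on' with
  | add p q hp hq =>
    simp only [Polynomial.eval_add, add_mul]
    exact hp.add hq
  | monomial n c =>
    have h := integrable_rpow_mul_exp_neg_mul_sq (b := 1) one_pos
      (s := (n : ℝ)) (lt_of_lt_of_le (by norm_num) (Nat.cast_nonneg n))
    have h2 := (h.ofReal (𝕜 := ℂ)).const_mul c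
    refine h2.congr (Eventually.of_forall fun x => ?_)
    simp [Real.rpow_natCast]
    ring

theorem integrable_hermiteFn_mul (i j : ℕ) :
    Integrable (fun x : ℝ => hermiteFn i x * hermiteFn j x) := by
  have h := (integrable_polynomial_mul_gaussian (monicHermite i * monicHermite j)).const_mul
    ((hermiteConst i : ℂ) * hermiteConst j)
  refine h.congr (Eventually.of_forall fun x => ?_)
  simp only [hermiteFn, Polynomial.eval_mul]
  have : Complex.exp (-(x : ℂ) ^ 2) = Complex.exp (-(x : ℂ) ^ 2 / 2) * Complex.exp (-(x : ℂ) ^ 2 / 2) := by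
    rw [← Complex.exp_add]; ring_nf
  rw [this]
  ring

/-- Integrate the derivative of a product, lowering one factor and raising the other, so that the
terms with a factor x cancel. Orthonormality then follows by induction on the second index. -/
theorem integral_hermiteFn_ladder (i j : ℕ) :
    ladder (j + 1) * ∫ x : ℝ, hermiteFn i x * hermiteFn (j + 1) x
      = ladder i * ∫ x : ℝ, hermiteFn (i - 1) x * hermiteFn j x := by
  have hd : ∀ x : ℝ, HasDerivAt (fun x : ℝ => hermiteFn i x * hermiteFn j x)
      (ladder i * (hermiteFn (i - 1) x * hermiteFn j x)
        - ladder (j + 1) * (hermiteFn i x * hermiteFn (j + 1) x)) x := fun x => by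
    refine ((hasDerivAt_hermiteFn_lower i x).comp_ofReal.mul
      (hasDerivAt_hermiteFn_raise j x).comp_ofReal).congr_deriv ?_
    ring
  have h1 := (integrable_hermiteFn_mul (i - 1) j).const_mul (ladder i)
  have h2 := (integrable_hermiteFn_mul i (j + 1)).const_mul (ladder (j + 1))
  have h := integral_eq_zero_of_hasDerivAt_of_integrable hd (h1.sub h2)
    (integrable_hermiteFn_mul i j)
  rw [integral_sub h1 h2, integral_const_mul, integral_const_mul] at h
  exact (sub_eq_zero.mp h).symm

theorem integral_hermiteFn_zero : ∫ x : ℝ, hermiteFn 0 x * hermiteFn 0 x = 1 := by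
  have h : ∀ x : ℝ, hermiteFn 0 x * hermiteFn 0 x
      = (((√Real.pi)⁻¹ * Real.exp (-1 * x ^ 2) : ℝ) : ℂ) := fun x => by
    have h1 : (hermiteConst 0 : ℂ) * hermiteConst 0 = (((√Real.pi)⁻¹ : ℝ) : ℂ) := by
      rw [← Complex.ofReal_mul, hermiteConst, ← mul_inv, Real.mul_self_sqrt (Real.sqrt_nonneg _)]
    have h2 : Complex.exp (-(x : ℂ) ^ 2 / 2) * Complex.exp (-(x : ℂ) ^ 2 / 2)
        = ((Real.exp (-1 * x ^ 2) : ℝ) : ℂ) := by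
      rw [← Complex.exp_add]
      push_cast
      ring_nf
    rw [Complex.ofReal_mul, ← h1, ← h2]
    simp only [hermiteFn, monicHermite, Polynomial.eval_one]
    ring
  simp_rw [h]
  rw [integral_complex_ofReal, integral_const_mul, integral_gaussian, div_one,
    inv_mul_cancel₀ (by positivity), Complex.ofReal_one]

theorem integral_hermiteFn_mul (i j : ℕ) :
    ∫ x : ℝ, hermiteFn i x * hermiteFn j x = if i = j then 1 else 0 := by
  induction j generalizing i with
  | zero =>
    cases i with
    | zero => simpa using integral_hermiteFn_zero
    | succ i =>
      have h := integral_hermiteFn_ladder 0 i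
      rw [ladder_zero, zero_mul] at h
      have h := (mul_eq_zero.mp h).resolve_left (ladder_succ_ne_zero i)
      simp_rw [mul_comm (hermiteFn (i + 1) _)]
      simpa using h
  | succ j ih =>
    have h := integral_hermiteFn_ladder i j
    rw [ih] at h
    refine mul_left_cancel₀ (ladder_succ_ne_zero j) ?_
    rw [h]
    cases i with
    | zero => simp
    | succ i =>
      by_cases hij : i = j
      · subst hij; simp
      · simp [hij]

/-! ### Integrals of entire functions over symmetric segments -/

/-- A primitive of an entire function that vanishes at the origin. -/
noncomputable def entirePrimitive (f : ℂ → ℂ) : ℂ → ℂ :=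
  Classical.epsilon fun g => g 0 = 0 ∧ ∀ z, HasDerivAt g (f z) z

theorem entirePrimitive_spec {f : ℂ → ℂ} (hf : Differentiable ℂ f) :
    entirePrimitive f 0 = 0 ∧ ∀ z, HasDerivAt (entirePrimitive f) (f z) z := by
  obtain ⟨g, hg, hg'⟩ := hf.isExactOn_univ.with_val_at 0 0
  exact Classical.epsilon_spec (p := fun g : ℂ → ℂ => g 0 = 0 ∧ ∀ z, HasDerivAt g (f z) z)
    ⟨g, hg, fun z => hg' z (mem_univ z)⟩

/-- The integral of an entire function from `-z` to `z`. -/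
noncomputable def symIntegral (f : ℂ → ℂ) (z : ℂ) : ℂ :=
  entirePrimitive f z - entirePrimitive f (-z)

@[simp] theorem symIntegral_zero (f : ℂ → ℂ) : symIntegral f 0 = 0 := by simp [symIntegral]

theorem hasDerivAt_symIntegral {f : ℂ → ℂ} (hf : Differentiable ℂ f) (z : ℂ) :
    HasDerivAt (symIntegral f) (f z + f (-z)) z := by
  have h := (entirePrimitive_spec hf).2
  have h2 := (h (-z)).comp z (hasDerivAt_neg z)
  exact ((h z).sub h2).congr_deriv (by ring)

theorem eq_of_hasDerivAt_of_eq_zero {f g f' : ℂ → ℂ} (hf : ∀ z, HasDerivAt f (f' z) z)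
    (hg : ∀ z, HasDerivAt g (f' z) z) (h0 : f 0 = g 0) (z : ℂ) : f z = g z := by
  have hd : ∀ z, HasDerivAt (fun z => f z - g z) 0 z := fun z =>
    ((hf z).sub (hg z)).congr_deriv (sub_self _)
  have := is_const_of_deriv_eq_zero (fun z => (hd z).differentiableAt) (fun z => (hd z).deriv) z 0
  simp only [h0, sub_self] at this
  exact sub_eq_zero.mp this

theorem symIntegral_eq_of_hasDerivAt {f H : ℂ → ℂ} (hf : Differentiable ℂ f)
    (hH : ∀ z, HasDerivAt H (f z + f (-z)) z) (h0 : H 0 = 0) (z : ℂ) : symIntegral f z = H z :=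
  eq_of_hasDerivAt_of_eq_zero (hasDerivAt_symIntegral hf) hH (by simp [h0]) z

theorem symIntegral_of_odd {f : ℂ → ℂ} (hf : Differentiable ℂ f) (ho : ∀ z, f (-z) = -f z)
    (z : ℂ) : symIntegral f z = 0 :=
  symIntegral_eq_of_hasDerivAt (H := fun _ => 0) hf
    (fun z => (hasDerivAt_const z (0 : ℂ)).congr_deriv (by rw [ho]; ring)) rfl z

theorem symIntegral_ofReal {f : ℂ → ℂ} (hf : Differentiable ℂ f) (a : ℝ) :
    symIntegral f a = ∫ x in (-a)..a, f x := by
  have h := (entirePrimitive_spec hf).2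
  rw [intervalIntegral.integral_eq_sub_of_hasDerivAt (f := fun x : ℝ => entirePrimitive f x)
    (fun x _ => (h x).comp_ofReal)
    ((hf.continuous.comp Complex.continuous_ofReal).intervalIntegrable _ _), symIntegral,
    Complex.ofReal_neg]

theorem norm_symIntegral_le {f : ℂ → ℂ} (hf : Differentiable ℂ f) {z : ℂ} {C : ℝ}
    (hC : ∀ w : ℂ, ‖w‖ ≤ ‖z‖ → ‖f w‖ ≤ C) : ‖symIntegral f z‖ ≤ 2 * ‖z‖ * C := by
  have h := (entirePrimitive_spec hf).2
  have key := (convex_closedBall (0 : ℂ) ‖z‖).norm_image_sub_le_of_norm_hasDerivWithin_le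
    (fun w _ => (h w).hasDerivWithinAt) (C := C)
    (fun w hw => hC w (by simpa using hw)) (x := -z) (y := z) (by simp) (by simp)
  refine key.trans (le_of_eq ?_)
  rw [sub_neg_eq_add, ← two_mul, norm_mul]
  simp
  ring

/-! ### The gap determinant -/

/-- The Gram matrix of the first `n` Hermite functions on the segment from `-z` to `z`. -/
noncomputable def gapGram (n : ℕ) (z : ℂ) : Matrix (Fin n) (Fin n) ℂ :=
  Matrix.of fun i j => symIntegral (fun w => hermiteFn i w * hermiteFn j w) z

/-- The analytic continuation of the gap probability of the Gaussian unitary ensemble. -/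
noncomputable def gapDet (n : ℕ) (z : ℂ) : ℂ := (1 - gapGram n z).det

theorem differentiable_hermiteFn_mul (i j : ℕ) :
    Differentiable ℂ fun w => hermiteFn i w * hermiteFn j w :=
  (differentiable_hermiteFn i).mul (differentiable_hermiteFn j)

/-! ### The gap probability as a determinant. -/

/-- **Andréief's identity**. -/
theorem integrable_and_integral_det_sq_mul_prod {n : ℕ} (f : Fin n → ℝ → ℂ) (v : ℝ → ℂ)
    (hf : ∀ i j, Integrable fun x => f i x * f j x * v x) :
    Integrable (fun x : Fin n → ℝ => (Matrix.of fun i j => f i (x j)).det ^ 2 * ∏ k, v (x k)) ∧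
    ∫ x : Fin n → ℝ, (Matrix.of fun i j => f i (x j)).det ^ 2 * ∏ k, v (x k)
      = n.factorial * (Matrix.of fun i j => ∫ x, f i x * f j x * v x).det := by
  have hexp : ∀ x : Fin n → ℝ, (Matrix.of fun i j => f i (x j)).det ^ 2 * ∏ k, v (x k)
      = ∑ s : Equiv.Perm (Fin n), ∑ t : Equiv.Perm (Fin n),
        ((Equiv.Perm.sign s : ℤ) : ℂ) * ((Equiv.Perm.sign t : ℤ) : ℂ)
          * ∏ k, (f (s k) (x k) * f (t k) (x k) * v (x k)) := fun x => by
    rw [sq, Matrix.det_apply', Finset.sum_mul_sum, Finset.sum_mul]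
    refine Finset.sum_congr rfl fun s _ => ?_
    rw [Finset.sum_mul]
    refine Finset.sum_congr rfl fun t _ => ?_
    rw [Finset.prod_mul_distrib, Finset.prod_mul_distrib]
    simp only [Matrix.of_apply]
    ring
  have hint : ∀ s t : Equiv.Perm (Fin n), Integrable fun x : Fin n → ℝ =>
      ((Equiv.Perm.sign s : ℤ) : ℂ) * ((Equiv.Perm.sign t : ℤ) : ℂ)
          * ∏ k, (f (s k) (x k) * f (t k) (x k) * v (x k)) := fun s t =>
    (Integrable.fintype_prod (f := fun k x => f (s k) x * f (t k) x * v x)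
      (fun k => hf (s k) (t k))).const_mul _
  simp_rw [hexp]
  refine ⟨integrable_finsetSum _ fun s _ => integrable_finsetSum _ fun t _ => hint s t, ?_⟩
  rw [integral_finsetSum _ fun s _ => integrable_finsetSum _ fun t _ => hint s t]
  set A : Matrix (Fin n) (Fin n) ℂ := Matrix.of fun i j => ∫ x, f i x * f j x * v x with hA
  -- For fixed s the sum over t is sign(s) times the determinant of a row permutation of `A`, that
  -- is det A; this leaves n! equal terms.
  have hs : ∀ s : Equiv.Perm (Fin n), (∫ x : Fin n → ℝ, ∑ t : Equiv.Perm (Fin n),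
      ((Equiv.Perm.sign s : ℤ) : ℂ) * ((Equiv.Perm.sign t : ℤ) : ℂ)
          * ∏ k, (f (s k) (x k) * f (t k) (x k) * v (x k))) = A.det := fun s => by
    rw [integral_finsetSum _ fun t _ => hint s t]
    have h1 : ∀ t : Equiv.Perm (Fin n), (∫ x : Fin n → ℝ,
        ((Equiv.Perm.sign s : ℤ) : ℂ) * ((Equiv.Perm.sign t : ℤ) : ℂ)
          * ∏ k, (f (s k) (x k) * f (t k) (x k) * v (x k)))
        = ((Equiv.Perm.sign s : ℤ) : ℂ) * (((Equiv.Perm.sign t : ℤ) : ℂ)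
          * ∏ k, (A.submatrix s id).transpose (t k) k) := fun t => by
      rw [integral_const_mul, mul_assoc]
      congr 2
      exact integral_fintype_prod_volume_eq_prod
        (fun k x => f (s k) x * f (t k) x * v x)
    simp_rw [h1]
    rw [← Finset.mul_sum, ← Matrix.det_apply', Matrix.det_transpose, Matrix.det_permute,
      ← mul_assoc, ← Int.cast_mul, ← Units.val_mul, Int.units_mul_self]
    simp
  rw [Finset.sum_congr rfl fun s _ => hs s, Finset.sum_const, Finset.card_univ, Fintype.card_perm,
    Fintype.card_fin, nsmul_eq_mul]

/-- Constants come out of the rows and Gaussians out of the columns. What remains is a matrix of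
monic polynomials of degrees 0, ..., n - 1, whose determinant is Vandermonde's. -/
theorem det_hermiteFn_sq {n : ℕ} (x : Fin n → ℝ) :
    (Matrix.of fun i j : Fin n => hermiteFn i (x j)).det ^ 2
      = (((∏ k : Fin n, hermiteConst k) ^ 2 * ((∏ i : Fin n, ∏ j ∈ Finset.Ioi i, (x j - x i) ^ 2)
        * ∏ k : Fin n, gueWeight (x k)) : ℝ) : ℂ) := by
  have h1 : (Matrix.of fun i j : Fin n => hermiteFn i (x j))
      = Matrix.of fun i j : Fin n => (hermiteConst i : ℂ) * (Matrix.of fun i j : Fin n =>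
        Complex.exp (-(x j : ℂ) ^ 2 / 2) * (Matrix.of fun j i : Fin n =>
          (monicHermite i).eval (x j : ℂ)).transpose i j) i j := by
    ext i j
    simp only [Matrix.of_apply, Matrix.transpose_apply, hermiteFn]
    ring
  rw [h1, Matrix.det_mul_column, Matrix.det_mul_row, Matrix.det_transpose,
    ← Matrix.det_eval_matrixOfPolynomials_eq_det_vandermonde (fun j => (x j : ℂ))
      (fun i : Fin n => monicHermite i) (fun i => (natDegree_monicHermite_and_monic i).1)
      (fun i => (natDegree_monicHermite_and_monic i).2), Matrix.det_vandermonde, mul_pow, mul_pow]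
  have h2 : (∏ i : Fin n, Complex.exp (-(x i : ℂ) ^ 2 / 2)) ^ 2
      = ((∏ k : Fin n, gueWeight (x k) : ℝ) : ℂ) := by
    rw [← Finset.prod_pow, Complex.ofReal_prod]
    refine Finset.prod_congr rfl fun k _ => ?_
    rw [gueWeight, ← Complex.exp_nat_mul]
    push_cast
    ring_nf
  rw [h2]
  simp_rw [← Finset.prod_pow]
  push_cast
  ring

theorem integrable_and_unitaryPartition_mul (n : ℕ) (v : ℝ → ℝ)
    (hv : ∀ i j : ℕ, Integrable fun x : ℝ => hermiteFn i x * hermiteFn j x * (v x : ℂ)) :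
    Integrable (fun x : Fin n → ℝ => (∏ i : Fin n, ∏ j ∈ Finset.Ioi i, (x j - x i) ^ 2)
      * ∏ k : Fin n, (gueWeight (x k) * v (x k))) ∧
    (((∏ k : Fin n, hermiteConst k) ^ 2 * unitaryPartition n (fun x => gueWeight x * v x) : ℝ) : ℂ)
      = (Matrix.of fun i j : Fin n =>
        ∫ x : ℝ, hermiteFn i x * hermiteFn j x * (v x : ℂ)).det := by
  have hc : (∏ k : Fin n, hermiteConst k) ^ 2 ≠ 0 :=
    (pow_pos (Finset.prod_pos fun (k : Fin n) _ => hermiteConst_pos (k : ℕ)) 2).ne'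
  obtain ⟨h1, h2⟩ := integrable_and_integral_det_sq_mul_prod
    (fun (i : Fin n) (x : ℝ) => hermiteFn i x) (fun x => (v x : ℂ)) (fun i j => hv i j)
  have hcongr : ∀ x : Fin n → ℝ, (Matrix.of fun i j : Fin n => hermiteFn i (x j)).det ^ 2
      * ∏ k, (v (x k) : ℂ) = (((∏ k : Fin n, hermiteConst k) ^ 2 *
        ((∏ i : Fin n, ∏ j ∈ Finset.Ioi i, (x j - x i) ^ 2)
        * ∏ k : Fin n, (gueWeight (x k) * v (x k))) : ℝ) : ℂ) := fun x => by
    rw [det_hermiteFn_sq, ← Complex.ofReal_prod, ← Complex.ofReal_mul, Finset.prod_mul_distrib]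
    congr 1
    ring
  simp_rw [hcongr] at h1 h2
  constructor
  · have h3 := (h1.re).const_mul ((∏ k : Fin n, hermiteConst k) ^ 2)⁻¹
    refine h3.congr (Eventually.of_forall fun x => ?_)
    simp only [RCLike.re_eq_complex_re, Complex.ofReal_re]
    rw [← mul_assoc, inv_mul_cancel₀ hc, one_mul]
  · rw [integral_complex_ofReal, integral_const_mul] at h2
    have hn : (n.factorial : ℂ) ≠ 0 := Nat.cast_ne_zero.mpr n.factorial_ne_zero
    refine mul_left_cancel₀ hn ?_
    rw [← h2, unitaryPartition]
    have hn' : (n.factorial : ℝ) ≠ 0 := Nat.cast_ne_zero.mpr n.factorial_ne_zero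
    rw [← Complex.ofReal_natCast, ← Complex.ofReal_mul]
    congr 1
    field_simp

/-- The indicator of the complement of `(-a, a)`. -/
noncomputable def gapCutoff (a x : ℝ) : ℝ := 1 - (Ioo (-a) a).indicator (fun _ => (1 : ℝ)) x

theorem gapCutoff_nonneg (a x : ℝ) : 0 ≤ gapCutoff a x := by
  by_cases h : x ∈ Ioo (-a) a <;> simp [gapCutoff, h]

theorem gapCutoff_anti {a b : ℝ} (hab : a ≤ b) (x : ℝ) : gapCutoff b x ≤ gapCutoff a x := by
  refine sub_le_sub_left ?_ _
  exact indicator_le_indicator_of_subset (Ioo_subset_Ioo (neg_le_neg hab) hab)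
    (fun _ => zero_le_one) x

theorem hermiteFn_mul_gapCutoff (i j : ℕ) (a x : ℝ) :
    hermiteFn i x * hermiteFn j x * (gapCutoff a x : ℂ) = hermiteFn i x * hermiteFn j x
      - (Ioo (-a) a).indicator (fun x : ℝ => hermiteFn i x * hermiteFn j x) x := by
  by_cases h : x ∈ Ioo (-a) a <;> simp [gapCutoff, h]

theorem integrable_hermiteFn_mul_gapCutoff (i j : ℕ) (a : ℝ) :
    Integrable fun x : ℝ => hermiteFn i x * hermiteFn j x * (gapCutoff a x : ℂ) := by
  simp_rw [hermiteFn_mul_gapCutoff]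
  exact (integrable_hermiteFn_mul i j).sub
    ((integrable_hermiteFn_mul i j).indicator measurableSet_Ioo)

theorem integral_hermiteFn_mul_gapCutoff (i j : ℕ) {a : ℝ} (ha : 0 ≤ a) :
    ∫ x : ℝ, hermiteFn i x * hermiteFn j x * (gapCutoff a x : ℂ)
      = (if i = j then 1 else 0) - symIntegral (fun w => hermiteFn i w * hermiteFn j w) a := by
  simp_rw [hermiteFn_mul_gapCutoff]
  rw [integral_sub (integrable_hermiteFn_mul i j)
    ((integrable_hermiteFn_mul i j).indicator measurableSet_Ioo), integral_hermiteFn_mul,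
    integral_indicator measurableSet_Ioo, symIntegral_ofReal (differentiable_hermiteFn_mul i j),
    intervalIntegral.integral_of_le (by linarith), integral_Ioc_eq_integral_Ioo]

theorem unitaryPartition_gueGapWeight (n : ℕ) {a : ℝ} (ha : 0 ≤ a) :
    (((∏ k : Fin n, hermiteConst k) ^ 2 * unitaryPartition n (gueGapWeight a) : ℝ) : ℂ)
      = gapDet n a := by
  have h := (integrable_and_unitaryPartition_mul n (gapCutoff a)
    fun i j => integrable_hermiteFn_mul_gapCutoff i j a).2
  refine h.trans ?_
  rw [gapDet]
  congr 1
  ext i j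
  rw [Matrix.of_apply, integral_hermiteFn_mul_gapCutoff i j ha, Matrix.sub_apply, Matrix.one_apply,
    gapGram, Matrix.of_apply]
  simp [Fin.ext_iff]

theorem unitaryPartition_gueWeight (n : ℕ) :
    (∏ k : Fin n, hermiteConst k) ^ 2 * unitaryPartition n gueWeight = 1 := by
  have h := (integrable_and_unitaryPartition_mul n (fun _ => 1)
    fun i j => by simpa using integrable_hermiteFn_mul i j).2
  simp only [mul_one, Complex.ofReal_one, integral_hermiteFn_mul] at h
  have h1 : (Matrix.of fun i j : Fin n => if (i : ℕ) = j then (1 : ℂ) else 0) = 1 := by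
    ext i j
    simp [Matrix.one_apply, Fin.ext_iff]
  rw [h1, Matrix.det_one] at h
  exact_mod_cast h

theorem gueGapProb_eq (n : ℕ) (a : ℝ) :
    gueGapProb a n
      = (∏ k : Fin n, hermiteConst k) ^ 2 * unitaryPartition n (gueGapWeight a) := by
  have h := unitaryPartition_gueWeight n
  have h0 : unitaryPartition n gueWeight ≠ 0 := right_ne_zero_of_mul_eq_one h
  rw [gueGapProb, div_eq_iff h0, mul_right_comm, h, one_mul]

theorem ofReal_gueGapProb (n : ℕ) {a : ℝ} (ha : 0 ≤ a) : (gueGapProb a n : ℂ) = gapDet n a := by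
  rw [gueGapProb_eq, unitaryPartition_gueGapWeight n ha]

theorem integrable_gueGapWeight (n : ℕ) (a : ℝ) :
    Integrable (fun x : Fin n → ℝ => (∏ i : Fin n, ∏ j ∈ Finset.Ioi i, (x j - x i) ^ 2)
      * ∏ k : Fin n, gueGapWeight a (x k)) :=
  (integrable_and_unitaryPartition_mul n (gapCutoff a)
    fun i j => integrable_hermiteFn_mul_gapCutoff i j a).1

theorem gueGapWeight_nonneg (a x : ℝ) : 0 ≤ gueGapWeight a x :=
  mul_nonneg (Real.exp_pos _).le (gapCutoff_nonneg a x)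

/-- Monotonicity survives the scaling limit, where it propagates a hypothetical zero of the limit to
the right. -/
theorem gueGapProb_anti (n : ℕ) {a b : ℝ} (hab : a ≤ b) : gueGapProb b n ≤ gueGapProb a n := by
  rw [gueGapProb_eq, gueGapProb_eq, unitaryPartition, unitaryPartition]
  refine mul_le_mul_of_nonneg_left (mul_le_mul_of_nonneg_left ?_ (by positivity)) (by positivity)
  refine integral_mono (integrable_gueGapWeight n b) (integrable_gueGapWeight n a) fun x => ?_
  refine mul_le_mul_of_nonneg_left ?_
    (Finset.prod_nonneg fun i _ => Finset.prod_nonneg fun j _ => sq_nonneg _)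
  exact Finset.prod_le_prod (fun k _ => gueGapWeight_nonneg b _)
    fun k _ => mul_le_mul_of_nonneg_left (gapCutoff_anti hab _) (Real.exp_pos _).le

theorem gueGapProb_pos (n : ℕ) (a : ℝ) : 0 < gueGapProb a n := by
  rw [gueGapProb_eq, unitaryPartition]
  refine mul_pos (pow_pos (Finset.prod_pos fun (k : Fin n) _ => hermiteConst_pos (k : ℕ)) 2)
    (mul_pos (by positivity) ?_)
  have hprod : ∀ x : Fin n → ℝ, 0 ≤ ∏ i : Fin n, ∏ j ∈ Finset.Ioi i, (x j - x i) ^ 2 := fun x =>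
    Finset.prod_nonneg fun i _ => Finset.prod_nonneg fun j _ => sq_nonneg _
  rw [integral_pos_iff_support_of_nonneg (fun x => mul_nonneg (hprod x)
    (Finset.prod_nonneg fun k _ => gueGapWeight_nonneg a _)) (integrable_gueGapWeight n a)]
  -- Points with distinct coordinates, all larger than `a`, form a nonempty open set on which the
  -- integrand does not vanish.
  have hopen : IsOpen ((⋂ i : Fin n, {x : Fin n → ℝ | a < x i})
      ∩ ⋂ i : Fin n, ⋂ j : Fin n, {x : Fin n → ℝ | i < j → x j ≠ x i}) := by
    refine (isOpen_iInter_of_finite fun i => isOpen_lt continuous_const (continuous_apply i)).inter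
      (isOpen_iInter_of_finite fun i => isOpen_iInter_of_finite fun j => ?_)
    by_cases hij : i < j
    · simp only [hij, forall_const]
      exact isOpen_ne_fun (continuous_apply j) (continuous_apply i)
    · simp [hij]
  refine lt_of_lt_of_le (hopen.measure_pos volume ⟨fun i => a + 1 + i, ?_⟩) (measure_mono ?_)
  · simp only [mem_inter_iff, mem_iInter, mem_ofPred_eq]
    refine ⟨fun i => ?_, fun i j hij h => ?_⟩
    · have : (0 : ℝ) ≤ (i : ℕ) := Nat.cast_nonneg _
      linarith
    · have h2 : ((j : ℕ) : ℝ) = ((i : ℕ) : ℝ) := by linarith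
      exact absurd (Nat.cast_injective h2) (Nat.ne_of_gt hij)
  · intro x hx
    simp only [mem_inter_iff, mem_iInter, mem_ofPred_eq] at hx
    rw [Function.mem_support]
    refine mul_ne_zero (Finset.prod_ne_zero_iff.mpr fun i _ => Finset.prod_ne_zero_iff.mpr
      fun j hj => pow_ne_zero 2 (sub_ne_zero.mpr (hx.2 i j (Finset.mem_Ioi.mp hj))))
      (Finset.prod_ne_zero_iff.mpr fun k _ => ?_)
    have hk : x k ∉ Ioo (-a) a := fun h => absurd (hx.1 k) (not_lt.mpr h.2.le)
    simp [gueGapWeight, gueWeight, hk]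

/-! ### The resolvent form of the gap determinant -/

open scoped Matrix

/-- The vector of the first `n` Hermite functions. -/
noncomputable def hermiteVec (n : ℕ) (z : ℂ) : Fin n → ℂ := fun j => hermiteFn j z

/-- The truncated lowering operator. -/
noncomputable def lowering (n : ℕ) : Matrix (Fin n) (Fin n) ℂ :=
  Matrix.of fun i j => if (i : ℕ) = j + 1 then ladder i else 0

/-- The last basis vector. -/
noncomputable def topVec (m : ℕ) : Fin (m + 1) → ℂ := Pi.single (Fin.last m) 1

/-- The integrals of the first `n` Hermite functions against the next one. -/
noncomputable def gapCross (n : ℕ) (z : ℂ) : Fin n → ℂ := fun j =>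
  symIntegral (fun w => hermiteFn n w * hermiteFn j w) z

/-- The bilinear form of the inverse of `1 - gapGram n z`. -/
noncomputable def gapForm (n : ℕ) (z : ℂ) (u v : Fin n → ℂ) : ℂ :=
  u ⬝ᵥ ((1 - gapGram n z)⁻¹ *ᵥ v)

theorem gapForm_add_left (n : ℕ) (z : ℂ) (u u' v : Fin n → ℂ) :
    gapForm n z (u + u') v = gapForm n z u v + gapForm n z u' v := by
  simp [gapForm, add_dotProduct]

theorem gapForm_sub_left (n : ℕ) (z : ℂ) (u u' v : Fin n → ℂ) :
    gapForm n z (u - u') v = gapForm n z u v - gapForm n z u' v := by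
  simp [gapForm, sub_dotProduct]

theorem gapForm_smul_left (n : ℕ) (z c : ℂ) (u v : Fin n → ℂ) :
    gapForm n z (c • u) v = c * gapForm n z u v := by
  simp [gapForm, smul_dotProduct]

theorem symIntegral_hermiteFn_comm (i j : ℕ) (z : ℂ) :
    symIntegral (fun w => hermiteFn i w * hermiteFn j w) z
      = symIntegral (fun w => hermiteFn j w * hermiteFn i w) z := by
  simp_rw [mul_comm (hermiteFn i _)]

theorem gapGram_transpose (n : ℕ) (z : ℂ) : (gapGram n z)ᵀ = gapGram n z := by
  ext i j
  exact symIntegral_hermiteFn_comm j i z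

theorem gapForm_comm (n : ℕ) (z : ℂ) (u v : Fin n → ℂ) :
    gapForm n z u v = gapForm n z v u := by
  have h : ((1 - gapGram n z)⁻¹)ᵀ = (1 - gapGram n z)⁻¹ := by
    rw [Matrix.transpose_nonsing_inv, Matrix.transpose_sub, Matrix.transpose_one,
      gapGram_transpose]
  rw [gapForm, gapForm, Matrix.dotProduct_mulVec, ← Matrix.mulVec_transpose, h, dotProduct_comm]

theorem gapForm_add_right (n : ℕ) (z : ℂ) (u v v' : Fin n → ℂ) :
    gapForm n z u (v + v') = gapForm n z u v + gapForm n z u v' := by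
  simp [gapForm, Matrix.mulVec_add]

theorem gapForm_sub_right (n : ℕ) (z : ℂ) (u v v' : Fin n → ℂ) :
    gapForm n z u (v - v') = gapForm n z u v - gapForm n z u v' := by
  simp [gapForm, Matrix.mulVec_sub]

theorem gapForm_smul_right (n : ℕ) (z c : ℂ) (u v : Fin n → ℂ) :
    gapForm n z u (c • v) = c * gapForm n z u v := by
  simp [gapForm, Matrix.mulVec_smul]

/-- Stated for an arbitrary sequence, because it is applied to Hermite functions, to their
derivatives and to their integrals. -/
theorem lowering_mulVec_hermiteVec (n : ℕ) (f : ℕ → ℂ) :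
    lowering n *ᵥ (fun j : Fin n => f j) = fun i : Fin n => ladder i * f (i - 1) := by
  ext i
  simp only [lowering, Matrix.mulVec, dotProduct, Matrix.of_apply, ite_mul, zero_mul]
  rcases Nat.eq_zero_or_pos (i : ℕ) with hi | hi
  · rw [hi]
    simp
  · rw [Finset.sum_eq_single (⟨i - 1, by omega⟩ : Fin n)]
    · simp [Nat.sub_add_cancel hi]
    · intro b _ hb
      refine if_neg fun h => hb ?_
      ext
      simp only
      omega
    · simp

/-- The last row would need the index m + 1, which lies outside the truncation; the `topVec` term
removes it. All the auxiliary quantities below originate from this edge term. -/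
theorem lowering_transpose_mulVec (m : ℕ) (f : ℕ → ℂ) :
    (lowering (m + 1))ᵀ *ᵥ (fun j : Fin (m + 1) => f j)
      = (fun i : Fin (m + 1) => ladder (i + 1) * f (i + 1))
        - (ladder (m + 1) * f (m + 1)) • topVec m := by
  ext i
  simp only [lowering, Matrix.mulVec, dotProduct, Matrix.transpose_apply, Matrix.of_apply,
    ite_mul, zero_mul, Pi.sub_apply, Pi.smul_apply, topVec, smul_eq_mul]
  by_cases hi : i = Fin.last m
  · subst hi
    simp only [Fin.val_last, Pi.single_eq_same, mul_one, sub_self]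
    refine Finset.sum_eq_zero fun j _ => if_neg ?_
    have := j.isLt
    omega
  · have hlt : (i : ℕ) < m := by
      have := i.isLt
      have h2 : (i : ℕ) ≠ m := fun h => hi (Fin.ext h)
      omega
    rw [Pi.single_eq_of_ne hi, Finset.sum_eq_single (⟨i + 1, by omega⟩ : Fin (m + 1))]
    · simp
    · intro b _ hb
      refine if_neg fun h => hb ?_
      ext
      simp only
      omega
    · simp

theorem lowering_mulVec_topVec (m : ℕ) : lowering (m + 1) *ᵥ topVec m = 0 := by
  ext i
  rw [topVec, Matrix.mulVec_single_one]
  simp only [lowering, Matrix.col_apply, Matrix.of_apply, Fin.val_last, Pi.zero_apply]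
  refine if_neg ?_
  have := i.isLt
  omega

theorem hasDerivAt_hermiteVec_lower (n : ℕ) (z : ℂ) (j : Fin n) :
    HasDerivAt (fun z => hermiteVec n z j)
      ((-z • hermiteVec n z + lowering n *ᵥ hermiteVec n z) j) z := by
  have h := lowering_mulVec_hermiteVec n (fun j => hermiteFn j z)
  change lowering n *ᵥ hermiteVec n z = _ at h
  rw [h]
  exact hasDerivAt_hermiteFn_lower j z

/-- Both sides are the derivative of the vector of Hermite functions. Equivalently, `lowering` plus
its transpose acts as multiplication by 2z up to the edge term. -/
theorem lowering_raise (m : ℕ) (z : ℂ) :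
    -z • hermiteVec (m + 1) z + lowering (m + 1) *ᵥ hermiteVec (m + 1) z
      = z • hermiteVec (m + 1) z - (lowering (m + 1))ᵀ *ᵥ hermiteVec (m + 1) z
        - (ladder (m + 1) * hermiteFn (m + 1) z) • topVec m := by
  have h := lowering_mulVec_hermiteVec (m + 1) (fun j => hermiteFn j z)
  have h2 := lowering_transpose_mulVec m (fun j => hermiteFn j z)
  change lowering (m + 1) *ᵥ hermiteVec (m + 1) z = _ at h
  change (lowering (m + 1))ᵀ *ᵥ hermiteVec (m + 1) z = _ at h2
  rw [h, h2]
  ext i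
  simp only [Pi.add_apply, Pi.sub_apply, Pi.smul_apply, smul_eq_mul, hermiteVec]
  linear_combination -hermiteFn_raise_eq_lower i z

/-- The analogue of `integral_hermiteFn_ladder` on a segment, where the boundary terms survive. -/
theorem symIntegral_ladder (i j : ℕ) (z : ℂ) :
    ladder i * symIntegral (fun w => hermiteFn (i - 1) w * hermiteFn j w) z
      - ladder (j + 1) * symIntegral (fun w => hermiteFn i w * hermiteFn (j + 1) w) z
      = hermiteFn i z * hermiteFn j z - hermiteFn i (-z) * hermiteFn j (-z) := by
  have hd : ∀ z : ℂ, HasDerivAt (fun z => hermiteFn i z * hermiteFn j z)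
      (ladder i * (hermiteFn (i - 1) z * hermiteFn j z)
        - ladder (j + 1) * (hermiteFn i z * hermiteFn (j + 1) z)) z := fun z => by
    refine ((hasDerivAt_hermiteFn_lower i z).mul
      (hasDerivAt_hermiteFn_raise j z)).congr_deriv ?_
    ring
  refine eq_of_hasDerivAt_of_eq_zero
    (g := fun z => hermiteFn i z * hermiteFn j z - hermiteFn i (-z) * hermiteFn j (-z)) (fun z =>
    ((hasDerivAt_symIntegral (differentiable_hermiteFn_mul (i - 1) j) z).const_mul (ladder i)).sub
    ((hasDerivAt_symIntegral (differentiable_hermiteFn_mul i (j + 1)) z).const_mul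
      (ladder (j + 1)))) (fun z => ?_) (by simp) z
  refine ((hd z).sub ((hd (-z)).comp z (hasDerivAt_neg z))).congr_deriv ?_
  ring

/-- Entrywise this is `symIntegral_ladder`: the two endpoints contribute one rank-one term each, and
the truncation edge contributes the third. -/
theorem lowering_commutator (m : ℕ) (z : ℂ) :
    lowering (m + 1) * gapGram (m + 1) z - gapGram (m + 1) z * lowering (m + 1)
      = Matrix.vecMulVec (hermiteVec (m + 1) z) (hermiteVec (m + 1) z)
        - Matrix.vecMulVec (hermiteVec (m + 1) (-z)) (hermiteVec (m + 1) (-z))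
        + ladder (m + 1) • Matrix.vecMulVec (gapCross (m + 1) z) (topVec m) := by
  ext i j
  have h1 : (lowering (m + 1) * gapGram (m + 1) z) i j
      = ladder i * symIntegral (fun w => hermiteFn (i - 1 : ℕ) w * hermiteFn j w) z :=
    congrFun (lowering_mulVec_hermiteVec (m + 1)
      (fun k => symIntegral (fun w => hermiteFn k w * hermiteFn j w) z)) i
  have h2 : (gapGram (m + 1) z * lowering (m + 1)) i j
      = ((lowering (m + 1))ᵀ *ᵥ (fun k : Fin (m + 1) =>
        symIntegral (fun w => hermiteFn i w * hermiteFn (k : ℕ) w) z)) j := by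
    simp [Matrix.mul_apply, Matrix.mulVec, dotProduct, gapGram, mul_comm]
  rw [lowering_transpose_mulVec m
    (fun k => symIntegral (fun w => hermiteFn i w * hermiteFn k w) z)] at h2
  simp only [Matrix.sub_apply, Matrix.add_apply, h1, h2, Matrix.vecMulVec_apply,
    Matrix.smul_apply, Pi.sub_apply, Pi.smul_apply, smul_eq_mul, hermiteVec, gapCross]
  have h3 := symIntegral_ladder i j z
  have h4 := symIntegral_hermiteFn_comm (m + 1) i z
  rw [h4]
  linear_combination h3

/-- `gapCross` is the row of the untruncated Gram matrix just outside the truncation. This formula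
closes the system: no Hermite function of higher index appears. -/
theorem lowering_transpose_gapCross (m : ℕ) (z : ℂ) :
    (lowering (m + 1))ᵀ *ᵥ gapCross (m + 1) z
      = ladder (m + 1) • (gapGram (m + 1) z *ᵥ topVec m)
        - hermiteFn (m + 1) z • hermiteVec (m + 1) z
        + hermiteFn (m + 1) (-z) • hermiteVec (m + 1) (-z)
        - (ladder (m + 1) * symIntegral (fun w => hermiteFn (m + 1) w * hermiteFn (m + 1) w) z)
          • topVec m := by
  have h2 := lowering_transpose_mulVec m
    (fun k => symIntegral (fun w => hermiteFn (m + 1) w * hermiteFn k w) z)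
  change (lowering (m + 1))ᵀ *ᵥ gapCross (m + 1) z = _ at h2
  rw [h2]
  ext j
  have h3 := symIntegral_ladder (m + 1) j z
  rw [Nat.add_sub_cancel] at h3
  have h4 : (gapGram (m + 1) z *ᵥ topVec m) j
      = symIntegral (fun w => hermiteFn m w * hermiteFn j w) z := by
    rw [topVec, Matrix.mulVec_single_one]
    exact symIntegral_hermiteFn_comm _ _ _
  simp only [Pi.add_apply, Pi.sub_apply, Pi.smul_apply, smul_eq_mul, hermiteVec, h4]
  linear_combination -h3

/-! ### The resolvent, the lowering operator and parity. -/

section Invertible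

variable {m : ℕ} {z : ℂ}

/-- For N = (1 - G)⁻¹ one has [N, L] = -N [L, G] N. Since [L, G] is a sum of three rank-one
matrices, each term splits into a product of two values of the form. -/
theorem gapForm_lowering (hz : gapDet (m + 1) z ≠ 0) (u v : Fin (m + 1) → ℂ) :
    gapForm (m + 1) z u (lowering (m + 1) *ᵥ v)
      - gapForm (m + 1) z ((lowering (m + 1))ᵀ *ᵥ u) v
      = -(gapForm (m + 1) z u (hermiteVec (m + 1) z) * gapForm (m + 1) z (hermiteVec (m + 1) z) v)
        + gapForm (m + 1) z u (hermiteVec (m + 1) (-z))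
          * gapForm (m + 1) z (hermiteVec (m + 1) (-z)) v
        - ladder (m + 1) * (gapForm (m + 1) z u (gapCross (m + 1) z)
          * gapForm (m + 1) z (topVec m) v) := by
  have hu : IsUnit (1 - gapGram (m + 1) z).det := isUnit_iff_ne_zero.mpr hz
  set N := (1 - gapGram (m + 1) z)⁻¹ with hN
  have h1 : N * (1 - gapGram (m + 1) z) = 1 := Matrix.nonsing_inv_mul _ hu
  have h2 : (1 - gapGram (m + 1) z) * N = 1 := Matrix.mul_nonsing_inv _ hu
  have h3 : N * lowering (m + 1) - lowering (m + 1) * N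
      = -(N * (lowering (m + 1) * gapGram (m + 1) z - gapGram (m + 1) z * lowering (m + 1)) * N) := by
    have : lowering (m + 1) * gapGram (m + 1) z - gapGram (m + 1) z * lowering (m + 1)
        = (1 - gapGram (m + 1) z) * lowering (m + 1)
          - lowering (m + 1) * (1 - gapGram (m + 1) z) := by noncomm_ring
    rw [this, Matrix.mul_sub, Matrix.sub_mul, ← Matrix.mul_assoc N, h1, Matrix.one_mul,
      ← Matrix.mul_assoc N, Matrix.mul_assoc (N * _), h2, Matrix.mul_one]
    abel
  have h4 : ∀ a b : Fin (m + 1) → ℂ, u ⬝ᵥ (N *ᵥ (Matrix.vecMulVec a b *ᵥ (N *ᵥ v)))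
      = (u ⬝ᵥ (N *ᵥ a)) * (b ⬝ᵥ (N *ᵥ v)) := fun a b => by
    rw [Matrix.vecMulVec_mulVec]
    simp [Matrix.mulVec_smul, dotProduct_smul, mul_comm]
  have h5 : gapForm (m + 1) z ((lowering (m + 1))ᵀ *ᵥ u) v
      = u ⬝ᵥ ((lowering (m + 1) * N) *ᵥ v) := by
    rw [gapForm, ← Matrix.mulVec_mulVec, Matrix.dotProduct_mulVec u, Matrix.mulVec_transpose]
  have h6 : gapForm (m + 1) z u (lowering (m + 1) *ᵥ v)
      = u ⬝ᵥ ((N * lowering (m + 1)) *ᵥ v) := by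
    rw [gapForm, Matrix.mulVec_mulVec]
  rw [h5, h6, ← dotProduct_sub, ← Matrix.sub_mulVec, h3, lowering_commutator, Matrix.neg_mulVec,
    ← Matrix.mulVec_mulVec, ← Matrix.mulVec_mulVec, Matrix.add_mulVec, Matrix.sub_mulVec,
    Matrix.smul_mulVec, Matrix.mulVec_add, Matrix.mulVec_sub, Matrix.mulVec_smul, dotProduct_neg,
    dotProduct_add, dotProduct_sub, dotProduct_smul, h4, h4, h4]
  simp only [gapForm, smul_eq_mul]
  ring

theorem gapForm_gapGram (hz : gapDet (m + 1) z ≠ 0) (u v : Fin (m + 1) → ℂ) :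
    gapForm (m + 1) z u (gapGram (m + 1) z *ᵥ v) = gapForm (m + 1) z u v - u ⬝ᵥ v := by
  have hu : IsUnit (1 - gapGram (m + 1) z).det := isUnit_iff_ne_zero.mpr hz
  have h1 := Matrix.nonsing_inv_mul _ hu
  have h2 : gapGram (m + 1) z *ᵥ v = v - (1 - gapGram (m + 1) z) *ᵥ v := by
    rw [Matrix.sub_mulVec, Matrix.one_mulVec]
    abel
  rw [h2, gapForm_sub_right, sub_right_inj, gapForm, Matrix.mulVec_mulVec, h1, Matrix.one_mulVec]

/-- Gram entries with i + j odd vanish, so the diagonal matrix of signs (-1)^j commutes with G and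
with its resolvent. This reduces values at -z to values at z. -/
theorem gapForm_sign (u v : Fin (m + 1) → ℂ) :
    gapForm (m + 1) z (fun j => (-1) ^ (j : ℕ) * u j) (fun j => (-1) ^ (j : ℕ) * v j)
      = gapForm (m + 1) z u v := by
  set J : Matrix (Fin (m + 1)) (Fin (m + 1)) ℂ := Matrix.diagonal fun j => (-1) ^ (j : ℕ) with hJ
  have hJJ : J * J = 1 := by
    rw [hJ, Matrix.diagonal_mul_diagonal, ← Matrix.diagonal_one]
    congr 1
    ext j
    rw [← mul_pow]
    simp
  have hG : J * gapGram (m + 1) z * J = gapGram (m + 1) z := by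
    ext i j
    rw [hJ, Matrix.mul_diagonal, Matrix.diagonal_mul, gapGram, Matrix.of_apply]
    rcases Nat.even_or_odd ((i : ℕ) + j) with h | h
    · rw [mul_right_comm, ← pow_add, h.neg_one_pow, one_mul]
    · rw [symIntegral_of_odd (differentiable_hermiteFn_mul i j) (fun w => ?_)]
      · simp
      · rw [hermiteFn_neg, hermiteFn_neg, mul_mul_mul_comm, ← pow_add, h.neg_one_pow]
        ring
  have hM : J * (1 - gapGram (m + 1) z) * J = 1 - gapGram (m + 1) z := by
    rw [Matrix.mul_sub, Matrix.sub_mul, hG, Matrix.mul_one, hJJ]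
  have hJi : J⁻¹ = J := Matrix.inv_eq_right_inv hJJ
  have hN : J * (1 - gapGram (m + 1) z)⁻¹ * J = (1 - gapGram (m + 1) z)⁻¹ := by
    conv_rhs => rw [← hM]
    rw [Matrix.mul_inv_rev, Matrix.mul_inv_rev, hJi, Matrix.mul_assoc]
  have hJv : ∀ w : Fin (m + 1) → ℂ, (fun j : Fin (m + 1) => (-1) ^ (j : ℕ) * w j) = J *ᵥ w := fun w => by
    ext j
    rw [hJ, Matrix.mulVec_diagonal]
  have hself : ∀ a b : Fin (m + 1) → ℂ, (J *ᵥ a) ⬝ᵥ b = a ⬝ᵥ (J *ᵥ b) := fun a b => by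
    rw [Matrix.dotProduct_mulVec, ← Matrix.mulVec_transpose, Matrix.diagonal_transpose]
  rw [hJv, hJv, gapForm, gapForm, hself,
    Matrix.mulVec_mulVec, Matrix.mulVec_mulVec, hN]

end Invertible

theorem hermiteVec_neg (n : ℕ) (z : ℂ) :
    hermiteVec n (-z) = fun j : Fin n => (-1) ^ (j : ℕ) * hermiteVec n z j :=
  funext fun j => hermiteFn_neg j z

theorem topVec_sign (m : ℕ) :
    (fun j : Fin (m + 1) => (-1) ^ (j : ℕ) * topVec m j) = (-1 : ℂ) ^ m • topVec m := by
  ext j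
  by_cases h : j = Fin.last m
  · subst h; simp [topVec]
  · simp [topVec, h]

theorem gapCross_sign (n : ℕ) (z : ℂ) :
    (fun j : Fin n => (-1) ^ (j : ℕ) * gapCross n z j) = (-1 : ℂ) ^ n • gapCross n z := by
  ext j
  rw [Pi.smul_apply, smul_eq_mul, gapCross]
  rcases Nat.even_or_odd (n + (j : ℕ)) with h | h
  · congr 1
    exact (neg_one_pow_congr (Nat.even_add.mp h)).symm
  · rw [symIntegral_of_odd (differentiable_hermiteFn_mul n j) (fun w => ?_)]
    · simp
    · rw [hermiteFn_neg, hermiteFn_neg, mul_mul_mul_comm, ← pow_add, h.neg_one_pow]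
      ring

/-! ### Derivatives of determinants and inverses -/

/-- Jacobi's formula, from the Leibniz expansion; the inner sums are determinants with one column
replaced by its derivative. -/
theorem hasDerivAt_det {n : ℕ} {A : ℂ → Matrix (Fin n) (Fin n) ℂ} {A' : Matrix (Fin n) (Fin n) ℂ}
    {z : ℂ} (hA : ∀ i j, HasDerivAt (fun z => A z i j) (A' i j) z) :
    HasDerivAt (fun z => (A z).det) ((A z).adjugate * A').trace z := by
  have h : ∀ s : Equiv.Perm (Fin n), HasDerivAt
      (fun z => ((Equiv.Perm.sign s : ℤ) : ℂ) * ∏ i, A z (s i) i)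
      (((Equiv.Perm.sign s : ℤ) : ℂ) *
        ∑ i, (∏ j ∈ Finset.univ.erase i, A z (s j) j) • A' (s i) i) z := fun s => by
    refine HasDerivAt.const_mul _ ?_
    have := HasDerivAt.finsetProd (u := Finset.univ) (f := fun i z => A z (s i) i)
      (fun i _ => hA (s i) i)
    refine this.congr_of_eventuallyEq (Eventually.of_forall fun w => ?_)
    simp
  have h2 := HasDerivAt.fun_sum (u := Finset.univ) fun s _ => h s
  have h3 : (fun z => (A z).det) = fun z => ∑ s : Equiv.Perm (Fin n),
      ((Equiv.Perm.sign s : ℤ) : ℂ) * ∏ i, A z (s i) i := funext fun z => Matrix.det_apply' _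
  rw [h3]
  refine h2.congr_deriv ?_
  have h4 : ∀ i, ((A z).adjugate * A') i i = ∑ s : Equiv.Perm (Fin n),
      ((Equiv.Perm.sign s : ℤ) : ℂ) * ((∏ j ∈ Finset.univ.erase i, A z (s j) j) * A' (s i) i) :=
    fun i => by
      have h5 : ((A z).adjugate * A') i i = ((A z).updateCol i fun k => A' k i).det := by
        rw [← Matrix.cramer_apply, Matrix.cramer_eq_adjugate_mulVec]
        rfl
      rw [h5, Matrix.det_apply']
      refine Finset.sum_congr rfl fun s _ => ?_
      congr 1
      rw [← Finset.prod_erase_mul _ _ (Finset.mem_univ i), Matrix.updateCol_self]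
      congr 1
      refine Finset.prod_congr rfl fun j hj => ?_
      rw [Matrix.updateCol_ne (Finset.ne_of_mem_erase hj)]
  rw [Matrix.trace]
  simp only [Matrix.diag_apply, h4, smul_eq_mul, Finset.mul_sum]
  exact Finset.sum_comm

/-- Cramer's rule gives differentiability of the entries; the value then comes from differentiating
A⁻¹ A = 1. -/
theorem hasDerivAt_inv_apply {n : ℕ} {A : ℂ → Matrix (Fin n) (Fin n) ℂ}
    {A' : Matrix (Fin n) (Fin n) ℂ} {z : ℂ} (hA : ∀ i j, HasDerivAt (fun z => A z i j) (A' i j) z)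
    (hz : (A z).det ≠ 0) (i j : Fin n) :
    HasDerivAt (fun z => (A z)⁻¹ i j) (-((A z)⁻¹ * A' * (A z)⁻¹) i j) z := by
  have hdet := hasDerivAt_det hA
  have hdiff : ∀ i j, DifferentiableAt ℂ (fun z => (A z)⁻¹ i j) z := fun i j => by
    have hadj : DifferentiableAt ℂ (fun z => (A z).adjugate i j) z := by
      simp_rw [Matrix.adjugate_apply]
      refine (hasDerivAt_det (A' := A'.updateRow j 0) fun k l => ?_).differentiableAt
      by_cases hk : k = j
      · subst hk
        simpa using hasDerivAt_const z ((Pi.single i (1 : ℂ) : Fin n → ℂ) l)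
      · simpa [hk] using hA k l
    have h := (hdet.differentiableAt.inv hz).mul hadj
    refine h.congr_of_eventuallyEq (Eventually.of_forall fun w => ?_)
    simp [Matrix.inv_def, Ring.inverse_eq_inv']
  set B : Matrix (Fin n) (Fin n) ℂ := Matrix.of fun i j => deriv (fun z => (A z)⁻¹ i j) z with hB
  have hB' : ∀ i j, HasDerivAt (fun z => (A z)⁻¹ i j) (B i j) z :=
    fun i j => (hdiff i j).hasDerivAt
  have hu : IsUnit (A z).det := isUnit_iff_ne_zero.mpr hz
  have hev : ∀ᶠ w in 𝓝 z, (A w).det ≠ 0 := hdet.continuousAt.eventually_ne hz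
  have hprod : B * A z + (A z)⁻¹ * A' = 0 := by
    ext i k
    have h1 : HasDerivAt (fun w => ∑ j, (A w)⁻¹ i j * A w j k)
        (∑ j, (B i j * A z j k + (A z)⁻¹ i j * A' j k)) z :=
      HasDerivAt.fun_sum fun j _ => (hB' i j).mul (hA j k)
    have h2 : (fun w => ∑ j, (A w)⁻¹ i j * A w j k) =ᶠ[𝓝 z]
        fun _ => (1 : Matrix (Fin n) (Fin n) ℂ) i k := by
      filter_upwards [hev] with w hw
      rw [← Matrix.nonsing_inv_mul _ (isUnit_iff_ne_zero.mpr hw), Matrix.mul_apply]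
    have h3 := h1.unique ((hasDerivAt_const z _).congr_of_eventuallyEq h2)
    rw [Finset.sum_add_distrib] at h3
    simpa [Matrix.add_apply, Matrix.mul_apply] using h3
  have h4 : B = -((A z)⁻¹ * A' * (A z)⁻¹) := by
    have h5 : B * A z = -((A z)⁻¹ * A') := eq_neg_of_add_eq_zero_left hprod
    calc B = B * A z * (A z)⁻¹ := by rw [Matrix.mul_assoc, Matrix.mul_nonsing_inv _ hu, Matrix.mul_one]
      _ = _ := by rw [h5, Matrix.neg_mul]
  have h6 := hB' i j
  rw [h4] at h6
  exact h6

theorem hasDerivAt_one_sub_gapGram (n : ℕ) (z : ℂ) (i j : Fin n) :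
    HasDerivAt (fun z => (1 - gapGram n z) i j)
      ((-(Matrix.vecMulVec (hermiteVec n z) (hermiteVec n z)
        + Matrix.vecMulVec (hermiteVec n (-z)) (hermiteVec n (-z)))) i j) z := by
  have h := (hasDerivAt_symIntegral (differentiable_hermiteFn_mul i j) z).const_sub
    ((1 : Matrix (Fin n) (Fin n) ℂ) i j)
  exact h

theorem differentiable_gapDet (n : ℕ) : Differentiable ℂ (gapDet n) := fun z =>
  (hasDerivAt_det (hasDerivAt_one_sub_gapGram n z)).differentiableAt

/-- Both endpoints of the segment move, so G' is the sum of the rank-one matrices at z and at -z;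
inserted in N' = N G' N they give the two product terms. -/
theorem hasDerivAt_gapForm {n : ℕ} {z : ℂ} (hz : gapDet n z ≠ 0) {u v : ℂ → Fin n → ℂ}
    {u' v' : Fin n → ℂ} (hu : ∀ i, HasDerivAt (fun z => u z i) (u' i) z)
    (hv : ∀ i, HasDerivAt (fun z => v z i) (v' i) z) :
    HasDerivAt (fun z => gapForm n z (u z) (v z))
      (gapForm n z u' (v z) + gapForm n z (u z) v'
        + gapForm n z (u z) (hermiteVec n z) * gapForm n z (hermiteVec n z) (v z)
        + gapForm n z (u z) (hermiteVec n (-z)) * gapForm n z (hermiteVec n (-z)) (v z)) z := by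
  have hN := hasDerivAt_inv_apply (hasDerivAt_one_sub_gapGram n z) hz
  set N := (1 - gapGram n z)⁻¹ with hNdef
  have h1 : HasDerivAt (fun w => ∑ i, u w i * ∑ j, (1 - gapGram n w)⁻¹ i j * v w j) _ z :=
    HasDerivAt.fun_sum fun i _ => (hu i).mul
      (HasDerivAt.fun_sum fun j _ => (hN i j).mul (hv j))
  refine h1.congr_deriv ?_
  have h4 : ∀ a b : Fin n → ℂ, u z ⬝ᵥ (N *ᵥ (Matrix.vecMulVec a b *ᵥ (N *ᵥ v z)))
      = (u z ⬝ᵥ (N *ᵥ a)) * (b ⬝ᵥ (N *ᵥ v z)) := fun a b => by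
    rw [Matrix.vecMulVec_mulVec]
    simp [Matrix.mulVec_smul, dotProduct_smul, mul_comm]
  have h5 : u z ⬝ᵥ ((N * (Matrix.vecMulVec (hermiteVec n z) (hermiteVec n z)
      + Matrix.vecMulVec (hermiteVec n (-z)) (hermiteVec n (-z))) * N) *ᵥ v z)
      = gapForm n z (u z) (hermiteVec n z) * gapForm n z (hermiteVec n z) (v z)
        + gapForm n z (u z) (hermiteVec n (-z)) * gapForm n z (hermiteVec n (-z)) (v z) := by
    rw [← Matrix.mulVec_mulVec, ← Matrix.mulVec_mulVec, Matrix.add_mulVec, Matrix.mulVec_add,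
      dotProduct_add, h4, h4]
    rfl
  rw [add_assoc, ← h5, gapForm, gapForm]
  simp only [Matrix.mul_neg, Matrix.neg_mul, Matrix.neg_apply, neg_neg, dotProduct, Matrix.mulVec,
    ← hNdef, Finset.sum_add_distrib, mul_add]
  ring

theorem hasDerivAt_gapDet {n : ℕ} {z : ℂ} (hz : gapDet n z ≠ 0) :
    HasDerivAt (gapDet n) (-gapDet n z * (gapForm n z (hermiteVec n z) (hermiteVec n z)
      + gapForm n z (hermiteVec n (-z)) (hermiteVec n (-z)))) z := by
  refine (hasDerivAt_det (hasDerivAt_one_sub_gapGram n z)).congr_deriv ?_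
  have hadj : (1 - gapGram n z).adjugate = gapDet n z • (1 - gapGram n z)⁻¹ := by
    rw [Matrix.inv_def, Ring.inverse_eq_inv', smul_smul]
    change _ = (gapDet n z * (gapDet n z)⁻¹) • _
    rw [mul_inv_cancel₀ hz, one_smul]
  have htr : ∀ a : Fin n → ℂ, ((1 - gapGram n z)⁻¹ * Matrix.vecMulVec a a).trace
      = gapForm n z a a := fun a => by
    rw [Matrix.mul_vecMulVec, Matrix.trace_vecMulVec, dotProduct_comm, gapForm]
  rw [hadj, Matrix.smul_mul, Matrix.trace_smul, Matrix.mul_neg, Matrix.trace_neg, Matrix.mul_add,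
    Matrix.trace_add, htr, htr, smul_eq_mul]
  ring

/-! ### The differential equations at finite `n` -/

/-- The resolvent kernel at `(z, z)`. -/
noncomputable def gapR (m : ℕ) (z : ℂ) : ℂ :=
  gapForm (m + 1) z (hermiteVec (m + 1) z) (hermiteVec (m + 1) z)

/-- The resolvent kernel at `(-z, z)`. -/
noncomputable def gapS (m : ℕ) (z : ℂ) : ℂ :=
  gapForm (m + 1) z (hermiteVec (m + 1) (-z)) (hermiteVec (m + 1) z)

/-- The resolvent applied to the top Hermite function of the ensemble, at `z`. -/
noncomputable def gapP (m : ℕ) (z : ℂ) : ℂ :=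
  gapForm (m + 1) z (topVec m) (hermiteVec (m + 1) z)

/-- The resolvent applied to the first Hermite function outside the ensemble, at `z`. -/
noncomputable def gapQ (m : ℕ) (z : ℂ) : ℂ :=
  hermiteFn (m + 1) z + gapForm (m + 1) z (gapCross (m + 1) z) (hermiteVec (m + 1) z)

/-- The last diagonal entry of the inverse of `1 - gapGram`. -/
noncomputable def gapOmega (m : ℕ) (z : ℂ) : ℂ := gapForm (m + 1) z (topVec m) (topVec m)

/-- The Schur complement of `1 - gapGram (m + 1)` in `1 - gapGram (m + 2)`. -/
noncomputable def gapUpsilon (m : ℕ) (z : ℂ) : ℂ :=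
  1 - symIntegral (fun w => hermiteFn (m + 1) w * hermiteFn (m + 1) w) z
    - gapForm (m + 1) z (gapCross (m + 1) z) (gapCross (m + 1) z)

/-- The derivative of the vector of Hermite functions. -/
noncomputable def hermiteVecDeriv (m : ℕ) (z : ℂ) : Fin (m + 1) → ℂ :=
  -z • hermiteVec (m + 1) z + lowering (m + 1) *ᵥ hermiteVec (m + 1) z

section Parity

variable (m : ℕ) (z : ℂ)

theorem neg_one_pow_mul_self (m : ℕ) : (-1 : ℂ) ^ m * (-1) ^ m = 1 := by
  rw [← mul_pow]; simp

theorem gapForm_neg_neg :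
    gapForm (m + 1) z (hermiteVec (m + 1) (-z)) (hermiteVec (m + 1) (-z)) = gapR m z := by
  rw [hermiteVec_neg, gapForm_sign, gapR]

theorem gapForm_top_neg :
    gapForm (m + 1) z (topVec m) (hermiteVec (m + 1) (-z)) = (-1) ^ m * gapP m z := by
  have h := gapForm_sign (z := z) (topVec m) (hermiteVec (m + 1) z)
  rw [topVec_sign, gapForm_smul_left, ← hermiteVec_neg] at h
  rw [gapP, ← h, ← mul_assoc, neg_one_pow_mul_self, one_mul]

theorem gapForm_cross_neg :
    gapForm (m + 1) z (gapCross (m + 1) z) (hermiteVec (m + 1) (-z))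
      = -(-1) ^ m * gapForm (m + 1) z (gapCross (m + 1) z) (hermiteVec (m + 1) z) := by
  have h := gapForm_sign (z := z) (gapCross (m + 1) z) (hermiteVec (m + 1) z)
  rw [gapCross_sign, gapForm_smul_left, ← hermiteVec_neg] at h
  rw [← h, pow_succ]
  linear_combination (-gapForm (m + 1) z (gapCross (m + 1) z) (hermiteVec (m + 1) (-z)))
    * neg_one_pow_mul_self m

theorem hermiteFn_succ_neg : hermiteFn (m + 1) (-z) = -(-1) ^ m * hermiteFn (m + 1) z := by
  rw [hermiteFn_neg, pow_succ]
  ring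

end Parity

theorem topVec_dotProduct_hermiteVec (m : ℕ) (z : ℂ) :
    topVec m ⬝ᵥ hermiteVec (m + 1) z = hermiteFn m z := by
  rw [topVec, single_one_dotProduct]
  rfl

/-! ### Algebraic relations and the closed differential system at finite n. -/

section Algebra

variable {m : ℕ} {z : ℂ} (hz : gapDet (m + 1) z ≠ 0)
include hz

/-- The raising form of the derivative is used, because its transpose moves onto `topVec`, which
`lowering` annihilates. -/
theorem gapForm_top_deriv :
    gapForm (m + 1) z (topVec m) (hermiteVecDeriv m z) = z * gapP m z - gapR m z * gapP m z
      + (-1) ^ m * gapS m z * gapP m z - ladder (m + 1) * gapOmega m z * gapQ m z := by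
  have hK := gapForm_lowering hz (hermiteVec (m + 1) z) (topVec m)
  rw [lowering_mulVec_topVec, gapForm_comm _ _ (hermiteVec (m + 1) z) (topVec m),
    gapForm_comm _ _ (hermiteVec (m + 1) (-z)) (topVec m), gapForm_top_neg,
    gapForm_comm _ _ _ (hermiteVec (m + 1) (-z)), gapForm_comm _ _ _ (gapCross (m + 1) z),
    gapForm_comm _ _ _ (topVec m)] at hK
  have h0 : gapForm (m + 1) z (hermiteVec (m + 1) z) (0 : Fin (m + 1) → ℂ) = 0 := by
    simp [gapForm]
  rw [h0] at hK
  rw [hermiteVecDeriv, lowering_raise, gapForm_sub_right, gapForm_sub_right, gapForm_smul_right,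
    gapForm_smul_right]
  simp only [gapP, gapR, gapS, gapOmega, gapQ] at hK ⊢
  linear_combination hK

theorem gapForm_cross_deriv :
    gapForm (m + 1) z (gapCross (m + 1) z) (hermiteVecDeriv m z)
      = -z * (gapQ m z - hermiteFn (m + 1) z) - gapQ m z * gapR m z
        - (-1) ^ m * gapQ m z * gapS m z + ladder (m + 1) * gapUpsilon m z * gapP m z
        - ladder (m + 1) * hermiteFn m z := by
  have hK := gapForm_lowering hz (gapCross (m + 1) z) (hermiteVec (m + 1) z)
  have hG := gapForm_gapGram hz (hermiteVec (m + 1) z) (topVec m)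
  rw [dotProduct_comm, topVec_dotProduct_hermiteVec, gapForm_comm,
    gapForm_comm _ _ _ (topVec m)] at hG
  rw [lowering_transpose_gapCross, gapForm_sub_left, gapForm_add_left, gapForm_sub_left,
    gapForm_smul_left, gapForm_smul_left, gapForm_smul_left, gapForm_smul_left, hG,
    gapForm_cross_neg, hermiteFn_succ_neg] at hK
  rw [hermiteVecDeriv, gapForm_add_right, gapForm_smul_right]
  simp only [gapP, gapR, gapS, gapUpsilon, gapQ] at hK ⊢
  linear_combination hK

/-- A Christoffel–Darboux formula for the resolvent at (-z, z): 2z is the distance between the two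
points, and the right side comes from the truncation edge. -/
theorem mul_gapS : 2 * z * gapS m z = ladder (m + 1) * (-1) ^ m * gapP m z * gapQ m z := by
  have h1 := congrArg (gapForm (m + 1) z (hermiteVec (m + 1) (-z))) (lowering_raise m z)
  have h2 := congrArg (gapForm (m + 1) z (hermiteVec (m + 1) z)) (lowering_raise m (-z))
  have hK1 := gapForm_lowering hz (hermiteVec (m + 1) (-z)) (hermiteVec (m + 1) z)
  have hK2 := gapForm_lowering hz (hermiteVec (m + 1) z) (hermiteVec (m + 1) (-z))
  simp only [gapForm_add_right, gapForm_sub_right, gapForm_smul_right, hermiteFn_succ_neg,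
    gapForm_comm (m + 1) z _ (gapCross (m + 1) z), gapForm_comm (m + 1) z _ (topVec m),
    gapForm_comm (m + 1) z ((lowering (m + 1))ᵀ *ᵥ _), gapForm_top_neg, gapForm_cross_neg,
    gapForm_comm (m + 1) z (hermiteVec (m + 1) z) (hermiteVec (m + 1) (-z))] at h1 h2 hK1 hK2
  simp only [gapP, gapS, gapQ] at *
  linear_combination (-1 / 2 : ℂ) * h1 + (1 / 2 : ℂ) * h2 + (1 / 2 : ℂ) * hK1 - (1 / 2 : ℂ) * hK2

/-- The commutator identity between `gapCross` and `topVec`. As `lowering` kills `topVec`, it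
contains no derivative and gives a first integral of the system. -/
theorem gapOmega_mul_gapUpsilon :
    ladder (m + 1) * gapOmega m z * gapUpsilon m z = ladder (m + 1) + 2 * gapP m z * gapQ m z := by
  have hK := gapForm_lowering hz (gapCross (m + 1) z) (topVec m)
  have h0 : gapForm (m + 1) z (gapCross (m + 1) z) (0 : Fin (m + 1) → ℂ) = 0 := by
    simp [gapForm]
  have hG := gapForm_gapGram hz (topVec m) (topVec m)
  have h1 : topVec m ⬝ᵥ topVec m = 1 := by
    rw [topVec, single_one_dotProduct, Pi.single_eq_same]
  rw [h1, gapForm_comm] at hG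
  simp only [lowering_mulVec_topVec, h0, lowering_transpose_gapCross, gapForm_sub_left,
    gapForm_add_left, gapForm_smul_left, hG, gapForm_cross_neg, hermiteFn_succ_neg,
    gapForm_comm (m + 1) z (hermiteVec _ _) (topVec m), gapForm_top_neg] at hK
  simp only [gapP, gapUpsilon, gapOmega, gapQ] at *
  linear_combination -hK + (hermiteFn (m + 1) z + gapForm (m + 1) z (gapCross (m + 1) z)
    (hermiteVec (m + 1) z)) * gapForm (m + 1) z (topVec m) (hermiteVec (m + 1) z)
    * neg_one_pow_mul_self m

/-- Adding the lowering and raising forms of the derivative cancels the terms with a factor z;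
`gapForm_lowering` evaluates the remainder. -/
theorem two_mul_gapForm_deriv :
    2 * gapForm (m + 1) z (hermiteVec (m + 1) z) (hermiteVecDeriv m z)
      = -gapR m z ^ 2 + gapS m z ^ 2 - ladder (m + 1) * gapP m z * gapQ m z := by
  have hK := gapForm_lowering hz (hermiteVec (m + 1) z) (hermiteVec (m + 1) z)
  have h1 : gapForm (m + 1) z (hermiteVec (m + 1) z) (hermiteVecDeriv m z)
      = -z * gapR m z + gapForm (m + 1) z (hermiteVec (m + 1) z)
        (lowering (m + 1) *ᵥ hermiteVec (m + 1) z) := by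
    rw [hermiteVecDeriv, gapForm_add_right, gapForm_smul_right, gapR]
  have h2 : gapForm (m + 1) z (hermiteVec (m + 1) z) (hermiteVecDeriv m z)
      = z * gapR m z - gapForm (m + 1) z (hermiteVec (m + 1) z)
        ((lowering (m + 1))ᵀ *ᵥ hermiteVec (m + 1) z)
        - ladder (m + 1) * hermiteFn (m + 1) z * gapP m z := by
    rw [hermiteVecDeriv, lowering_raise, gapForm_sub_right, gapForm_sub_right, gapForm_smul_right,
      gapForm_smul_right, gapR, gapP, gapForm_comm _ _ _ (topVec m)]
  simp only [gapForm_comm (m + 1) z _ (gapCross (m + 1) z),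
    gapForm_comm (m + 1) z ((lowering (m + 1))ᵀ *ᵥ _),
    gapForm_comm (m + 1) z (hermiteVec (m + 1) z) (hermiteVec (m + 1) (-z))] at hK
  simp only [gapR, gapS, gapP, gapQ] at *
  linear_combination h1 + h2 + hK

-- The derivative in z of the three-term recurrence 2zφ = (L + Lᵀ)φ + edge term.
omit hz in
theorem hermiteVecDeriv_recurrence (m : ℕ) (z : ℂ) :
    (2 : ℂ) • hermiteVec (m + 1) z + (2 * z) • hermiteVecDeriv m z
      = lowering (m + 1) *ᵥ hermiteVecDeriv m z + (lowering (m + 1))ᵀ *ᵥ hermiteVecDeriv m z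
        + (ladder (m + 1) * (-z * hermiteFn (m + 1) z + ladder (m + 1) * hermiteFn m z))
          • topVec m := by
  set f : ℕ → ℂ := fun j => -z * hermiteFn j z + ladder j * hermiteFn (j - 1) z with hf
  have hv : hermiteVecDeriv m z = fun j : Fin (m + 1) => f j := by
    have h := lowering_mulVec_hermiteVec (m + 1) (fun j => hermiteFn j z)
    change lowering (m + 1) *ᵥ hermiteVec (m + 1) z = _ at h
    rw [hermiteVecDeriv, h]
    rfl
  have hfm : -z * hermiteFn (m + 1) z + ladder (m + 1) * hermiteFn m z = f (m + 1) := rfl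
  rw [hfm, hv, lowering_mulVec_hermiteVec, lowering_transpose_mulVec]
  ext j
  simp only [Pi.add_apply, Pi.sub_apply, Pi.smul_apply, smul_eq_mul, hermiteVec]
  have hd : ∀ j : ℕ, HasDerivAt (hermiteFn j) (f j) z := fun j => hasDerivAt_hermiteFn_lower j z
  have h1 : HasDerivAt (fun z => 2 * z * hermiteFn j z)
      (ladder j * f (j - 1) + ladder (j + 1) * f (j + 1)) z := by
    refine (((hd (j - 1)).const_mul (ladder j)).add
      ((hd (j + 1)).const_mul (ladder (j + 1)))).congr_of_eventuallyEq
      (Eventually.of_forall fun w => ?_)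
    have := hermiteFn_raise_eq_lower j w
    simp only [Pi.add_apply]
    linear_combination this
  have h2 : HasDerivAt (fun z => 2 * z * hermiteFn j z) (2 * hermiteFn j z + 2 * z * f j) z := by
    refine (((hasDerivAt_id z).const_mul 2).mul (hd j)).congr_deriv ?_
    simp
  linear_combination h2.unique h1

/-- The confluent Christoffel–Darboux formula. The differentiated recurrence is paired with φ and
`lowering_raise` with φ'; the terms 2z⟨φ, φ'⟩ cancel, and 2R is left from differentiating the factor
2z. -/
theorem two_mul_gapR :
    2 * gapR m z = ladder (m + 1) ^ 2 * (gapUpsilon m z * gapP m z ^ 2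
      + gapOmega m z * gapQ m z ^ 2) - 2 * ladder (m + 1) * z * gapP m z * gapQ m z
      - 2 * ladder (m + 1) * (-1) ^ m * gapS m z * gapP m z * gapQ m z := by
  have h1 := congrArg (gapForm (m + 1) z (hermiteVec (m + 1) z)) (hermiteVecDeriv_recurrence m z)
  have h2 := congrArg (gapForm (m + 1) z (hermiteVecDeriv m z)) (lowering_raise m z)
  have hK1 := gapForm_lowering hz (hermiteVec (m + 1) z) (hermiteVecDeriv m z)
  have hK2 := gapForm_lowering hz (hermiteVecDeriv m z) (hermiteVec (m + 1) z)
  have hT := gapForm_top_deriv hz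
  have hC := gapForm_cross_deriv hz
  simp only [gapForm_add_right, gapForm_sub_right, gapForm_smul_right,
    gapForm_comm (m + 1) z _ (gapCross (m + 1) z), gapForm_comm (m + 1) z _ (topVec m),
    gapForm_comm (m + 1) z ((lowering (m + 1))ᵀ *ᵥ _), hT, hC,
    gapForm_comm (m + 1) z (hermiteVecDeriv m z) (hermiteVec (m + 1) _),
    gapForm_comm (m + 1) z (hermiteVec (m + 1) z) (hermiteVec (m + 1) (-z))] at h1 h2 hK1 hK2
  simp only [gapR, gapS, gapP, gapQ, gapOmega, gapUpsilon] at *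
  linear_combination h1 + h2 + hK1 - hK2

theorem hasDerivAt_gapR :
    HasDerivAt (gapR m) (2 * gapS m z ^ 2 - 2 * (-1) ^ m * z * gapS m z) z := by
  have hv := fun j => hasDerivAt_hermiteVec_lower (m + 1) z j
  refine (hasDerivAt_gapForm hz hv hv).congr_deriv ?_
  have h1 := two_mul_gapForm_deriv hz
  have h2 := mul_gapS hz
  have h3 := gapForm_comm (m + 1) z (hermiteVec (m + 1) z) (hermiteVec (m + 1) (-z))
  have h4 := gapForm_comm (m + 1) z (hermiteVecDeriv m z) (hermiteVec (m + 1) z)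
  have hs := neg_one_pow_mul_self m
  change gapForm (m + 1) z (hermiteVecDeriv m z) _ + gapForm (m + 1) z _ (hermiteVecDeriv m z)
    + _ + _ = _
  rw [h4, h3]
  simp only [gapR, gapS, gapP, gapQ] at *
  linear_combination h1 + (-1) ^ m * h2 + ladder (m + 1) *
    gapForm (m + 1) z (topVec m) (hermiteVec (m + 1) z) * (hermiteFn (m + 1) z +
      gapForm (m + 1) z (gapCross (m + 1) z) (hermiteVec (m + 1) z)) * hs

theorem hasDerivAt_gapP :
    HasDerivAt (gapP m) (z * gapP m z + 2 * (-1) ^ m * gapS m z * gapP m z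
      - ladder (m + 1) * gapOmega m z * gapQ m z) z := by
  have hv := fun j => hasDerivAt_hermiteVec_lower (m + 1) z j
  refine (hasDerivAt_gapForm hz (u := fun _ => topVec m) (u' := 0)
    (fun j => hasDerivAt_const z _) hv).congr_deriv ?_
  have h0 : gapForm (m + 1) z 0 (hermiteVec (m + 1) z) = 0 := by simp [gapForm]
  have h1 := gapForm_top_deriv hz
  rw [hermiteVecDeriv] at h1
  rw [h0, h1, gapForm_top_neg]
  simp only [gapR, gapS, gapP, gapQ, gapOmega]
  ring

theorem hasDerivAt_gapQ :
    HasDerivAt (gapQ m) (-z * gapQ m z - 2 * (-1) ^ m * gapS m z * gapQ m z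
      + ladder (m + 1) * gapUpsilon m z * gapP m z) z := by
  have hv := fun j => hasDerivAt_hermiteVec_lower (m + 1) z j
  have hg : ∀ j, HasDerivAt (fun z => gapCross (m + 1) z j)
      ((hermiteFn (m + 1) z • hermiteVec (m + 1) z
        + hermiteFn (m + 1) (-z) • hermiteVec (m + 1) (-z)) j) z := fun j =>
    hasDerivAt_symIntegral (differentiable_hermiteFn_mul (m + 1) j) z
  refine ((hasDerivAt_hermiteFn_lower (m + 1) z).add (hasDerivAt_gapForm hz hg hv)).congr_deriv ?_
  have h1 := gapForm_cross_deriv hz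
  rw [hermiteVecDeriv] at h1
  rw [h1, gapForm_cross_neg, gapForm_add_left, gapForm_smul_left, gapForm_smul_left,
    hermiteFn_succ_neg, Nat.add_sub_cancel]
  simp only [gapR, gapS, gapP, gapQ]
  ring

/-- Only existence is needed: the value of the derivative is read off from `mul_gapS`. -/
theorem differentiableAt_gapS : DifferentiableAt ℂ (gapS m) z := by
  have hv := fun j => hasDerivAt_hermiteVec_lower (m + 1) z j
  have hv' : ∀ j, HasDerivAt (fun z => hermiteVec (m + 1) (-z) j)
      (-deriv (fun z => hermiteVec (m + 1) z j) (-z)) z := fun j => by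
    have h := ((hasDerivAt_hermiteVec_lower (m + 1) (-z) j).differentiableAt.hasDerivAt).comp z
      (hasDerivAt_neg z)
    exact h.congr_deriv (by ring)
  exact (hasDerivAt_gapForm hz hv' hv).differentiableAt

/-- The first integral relating the derivatives of `z * gapR` and `z * gapS`. -/
theorem gapS_deriv_relation :
    (gapR m z + 2 * z * gapS m z ^ 2 + 2 * (-1) ^ m * z ^ 2 * gapS m z) ^ 2
      - (gapS m z + z * deriv (gapS m) z) ^ 2
      = (8 * (m + 1) + 16 * (-1) ^ m * z * gapS m z) * (z ^ 2 * gapS m z ^ 2) := by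
  have hev : ∀ᶠ w in 𝓝 z, gapDet (m + 1) w ≠ 0 :=
    (differentiable_gapDet (m + 1) z).continuousAt.eventually_ne hz
  have h1 : HasDerivAt (fun w => 2 * w * gapS m w)
      (2 * (gapS m z + z * deriv (gapS m) z)) z := by
    refine (((hasDerivAt_id z).const_mul 2).mul
      (differentiableAt_gapS hz).hasDerivAt).congr_deriv ?_
    simp only [id_eq]
    ring
  have h2 := (((hasDerivAt_gapP hz).const_mul (ladder (m + 1) * (-1) ^ m)).mul
    (hasDerivAt_gapQ hz)).congr_of_eventuallyEq (hev.mono fun w hw => mul_gapS hw)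
  have h3 := h1.unique h2
  -- Up to a sign, `h4` and `h8` are the difference and the sum of the same two terms ΥP² and ΩQ²
  -- with the same factor. The difference of their squares is thus a multiple of ΥΩ(PQ)², where
  -- `h10` evaluates ΥΩ and `mul_gapS` evaluates PQ.
  have h4 : gapS m z + z * deriv (gapS m) z = ladder (m + 1) ^ 2 * (-1) ^ m / 2 *
      (gapUpsilon m z * gapP m z ^ 2 - gapOmega m z * gapQ m z ^ 2) := by
    linear_combination h3 / 2
  have h5 := mul_gapS hz
  have h6 := two_mul_gapR hz
  have h7 := gapOmega_mul_gapUpsilon hz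
  have hs := neg_one_pow_mul_self m
  have hl := ladder_sq (m + 1)
  push_cast at hl
  have h8 : gapR m z + 2 * z * gapS m z ^ 2 + 2 * (-1) ^ m * z ^ 2 * gapS m z
      = ladder (m + 1) ^ 2 / 2 *
        (gapUpsilon m z * gapP m z ^ 2 + gapOmega m z * gapQ m z ^ 2) := by
    have h9 : ladder (m + 1) * gapP m z * gapQ m z = (-1) ^ m * (2 * z * gapS m z) := by
      rw [h5]
      linear_combination -(ladder (m + 1) * gapP m z * gapQ m z) * hs
    linear_combination h6 / 2 - (z + (-1) ^ m * gapS m z) * h9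
      - 2 * z * gapS m z ^ 2 * hs
  have h10 : ladder (m + 1) ^ 2 * (gapUpsilon m z * gapOmega m z)
      = 2 * (m + 1) + 4 * (-1) ^ m * z * gapS m z := by
    linear_combination ladder (m + 1) * h7 + hl - 2 * (-1) ^ m * h5
      - 2 * ladder (m + 1) * gapP m z * gapQ m z * hs
  rw [h8, h4]
  linear_combination (z ^ 2 * gapS m z ^ 2 * 4) * h10
    - ladder (m + 1) ^ 2 * (gapUpsilon m z * gapOmega m z) * (2 * z * gapS m z
      + ladder (m + 1) * (-1) ^ m * gapP m z * gapQ m z) * h5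
    - ladder (m + 1) ^ 4 / 4 *
      (gapUpsilon m z * gapP m z ^ 2 + gapOmega m z * gapQ m z ^ 2) ^ 2 * hs

end Algebra

/-! ### Values at the origin -/

/-- The squares of the Hermite functions at the origin. -/
noncomputable def hermiteSqZero : ℕ → ℝ
  | 0 => (√Real.pi)⁻¹
  | 1 => 0
  | n + 2 => (n + 1) / (n + 2) * hermiteSqZero n

theorem hermiteSqZero_nonneg (n : ℕ) : 0 ≤ hermiteSqZero n := by
  induction n using Nat.strong_induction_on with
  | _ n ih =>
    match n with
    | 0 => rw [hermiteSqZero]; positivity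
    | 1 => rw [hermiteSqZero]
    | n + 2 =>
      rw [hermiteSqZero]
      have := ih n (by omega)
      positivity

theorem hermiteFn_zero_sq (n : ℕ) : hermiteFn n 0 ^ 2 = (hermiteSqZero n : ℂ) := by
  induction n using Nat.strong_induction_on with
  | _ n ih =>
    match n with
    | 0 =>
      rw [hermiteSqZero, hermiteFn, hermiteConst, monicHermite]
      simp only [Polynomial.eval_one, mul_one]
      rw [zero_pow two_ne_zero, neg_zero, zero_div, Complex.exp_zero, mul_one,
        ← Complex.ofReal_pow, inv_pow, Real.sq_sqrt (Real.sqrt_nonneg _)]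
    | 1 => simp [hermiteSqZero, hermiteFn, monicHermite]
    | n + 2 =>
      rw [hermiteSqZero]
      have h := hermiteFn_raise_eq_lower (n + 1) 0
      rw [Nat.add_sub_cancel] at h
      have h1 : ladder (n + 2) * hermiteFn (n + 2) 0 = -(ladder (n + 1) * hermiteFn n 0) := by
        linear_combination -h
      have h2 : ladder (n + 2) ^ 2 * hermiteFn (n + 2) 0 ^ 2
          = ladder (n + 1) ^ 2 * hermiteFn n 0 ^ 2 := by
        rw [← mul_pow, h1, neg_sq, mul_pow]
      rw [ladder_sq, ladder_sq, ih n (by omega)] at h2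
      have h3 : ((n : ℂ) + 2) ≠ 0 := by exact_mod_cast (Nat.succ_ne_zero (n + 1))
      push_cast at h2 ⊢
      field_simp
      linear_combination h2 / 2

theorem norm_hermiteFn_zero_sq (n : ℕ) : ‖hermiteFn n 0‖ ^ 2 = hermiteSqZero n := by
  rw [← norm_pow, hermiteFn_zero_sq, Complex.norm_real, Real.norm_of_nonneg
    (hermiteSqZero_nonneg n)]

theorem sum_hermiteSqZero (m : ℕ) : ∑ j ∈ Finset.range (m + 1), hermiteSqZero j
    = (m + 1) * (hermiteSqZero m + hermiteSqZero (m + 1)) := by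
  induction m with
  | zero => simp [hermiteSqZero]
  | succ m ih =>
    rw [Finset.sum_range_succ, ih]
    conv_rhs => rw [hermiteSqZero]
    push_cast
    field_simp
    ring

theorem hermiteSqZero_odd (k : ℕ) : hermiteSqZero (2 * k + 1) = 0 := by
  induction k with
  | zero => rfl
  | succ k ih =>
    have : 2 * (k + 1) + 1 = 2 * k + 1 + 2 := by ring
    rw [this, hermiteSqZero, ih, mul_zero]

/-- Wallis' product enters here, and through it the value of the limiting density 1/π. -/
theorem hermiteSqZero_even (k : ℕ) :
    (2 * k + 1) * hermiteSqZero (2 * k) ^ 2 = (Real.pi * Real.Wallis.W k)⁻¹ := by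
  induction k with
  | zero =>
    simp [hermiteSqZero, Real.Wallis.W, Real.sq_sqrt Real.pi_pos.le]
  | succ k ih =>
    have h2 : 2 * (k + 1) = 2 * k + 2 := by ring
    have hW := Real.Wallis.W_pos k
    have hpi := Real.pi_pos
    rw [h2, hermiteSqZero, Real.Wallis.W_succ]
    rw [eq_comm, inv_eq_iff_eq_inv, eq_comm] at ih
    have h4 : Real.pi * Real.Wallis.W k ≠ 0 := by positivity
    rw [← mul_assoc, ← ih]
    rw [← ih] at h4
    have h5 : (2 * (k : ℝ) + 1) * hermiteSqZero (2 * k) ^ 2 ≠ 0 := fun h => h4 (by rw [h, inv_zero])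
    have h6 := right_ne_zero_of_mul h5
    push_cast
    field_simp
    ring

/-- Exactly one of m and m + 1 is even, namely 2⌊(m+1)/2⌋, and the odd term vanishes. -/
theorem hermiteSqZero_add_succ (m : ℕ) :
    hermiteSqZero m + hermiteSqZero (m + 1) = hermiteSqZero (2 * ((m + 1) / 2)) := by
  rcases Nat.even_or_odd' m with ⟨k, rfl | rfl⟩
  · rw [hermiteSqZero_odd, add_zero]
    congr 1
    omega
  · rw [hermiteSqZero_odd, zero_add]
    congr 1
    omega

theorem tendsto_hermiteSqZero :
    Tendsto (fun m : ℕ => ((m : ℝ) + 1) * (hermiteSqZero m + hermiteSqZero (m + 1)) ^ 2) atTop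
      (𝓝 (2 / Real.pi ^ 2)) := by
  have hpi := Real.pi_pos
  have h1 : Tendsto (fun k : ℕ => (2 * (k : ℝ) + 1) * hermiteSqZero (2 * k) ^ 2) atTop
      (𝓝 (2 / Real.pi ^ 2)) := by
    simp_rw [hermiteSqZero_even]
    have := (Real.Wallis.tendsto_W_nhds_pi_div_two.const_mul Real.pi).inv₀ (by positivity)
    convert this using 2
    field_simp
  have hdiv : Tendsto (fun m : ℕ => (m + 1) / 2) atTop atTop :=
    tendsto_atTop_atTop.mpr fun b => ⟨2 * b, fun a ha => by omega⟩
  have h2 := h1.comp hdiv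
  have h3 : Tendsto (fun m : ℕ => ((m : ℝ) + 1) / (2 * (((m + 1) / 2 : ℕ) : ℝ) + 1)) atTop
      (𝓝 1) := by
    have hl : Tendsto (fun m : ℕ => 1 - 1 / ((m : ℝ) + 1)) atTop (𝓝 1) := by
      simpa using tendsto_one_div_add_atTop_nhds_zero_nat.const_sub (1 : ℝ)
    refine tendsto_of_tendsto_of_tendsto_of_le_of_le hl tendsto_const_nhds (fun m => ?_)
      (fun m => ?_)
    · have h4 : 2 * (((m + 1) / 2 : ℕ) : ℝ) ≤ (m : ℝ) + 1 := by
        exact_mod_cast (by omega : 2 * ((m + 1) / 2) ≤ m + 1)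
      have h5 : (0 : ℝ) < (m : ℝ) + 1 := by positivity
      have h6 : (0 : ℝ) ≤ (((m + 1) / 2 : ℕ) : ℝ) := Nat.cast_nonneg _
      rw [le_div_iff₀ (by positivity)]
      have h7 : (1 - 1 / ((m : ℝ) + 1)) = m / ((m : ℝ) + 1) := by field_simp; ring
      rw [h7, div_mul_eq_mul_div, div_le_iff₀ h5]
      have hm : (0 : ℝ) ≤ m := Nat.cast_nonneg m
      nlinarith
    · have h4 : (m : ℝ) + 1 ≤ 2 * (((m + 1) / 2 : ℕ) : ℝ) + 1 := by
        exact_mod_cast (by omega : m + 1 ≤ 2 * ((m + 1) / 2) + 1)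
      exact div_le_one_of_le₀ h4 (by positivity)
  have h4 := h3.mul h2
  rw [one_mul] at h4
  refine h4.congr fun m => ?_
  rw [hermiteSqZero_add_succ]
  simp only [Function.comp_apply]
  field_simp

theorem gapForm_zero (n : ℕ) (u v : Fin n → ℂ) : gapForm n 0 u v = u ⬝ᵥ v := by
  have h : gapGram n 0 = 0 := by
    ext i j
    exact symIntegral_zero _
  rw [gapForm, h, sub_zero, inv_one, Matrix.one_mulVec]

theorem gapDet_zero (n : ℕ) : gapDet n 0 = 1 := by
  have h : gapGram n 0 = 0 := by
    ext i j
    exact symIntegral_zero _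
  rw [gapDet, h, sub_zero, Matrix.det_one]

theorem gapR_zero (m : ℕ) :
    gapR m 0 = (((m + 1) * (hermiteSqZero m + hermiteSqZero (m + 1)) : ℝ) : ℂ) := by
  rw [← sum_hermiteSqZero, gapR, gapForm_zero, dotProduct, Complex.ofReal_sum,
    ← Fin.sum_univ_eq_sum_range (fun j => ((hermiteSqZero j : ℝ) : ℂ))]
  refine Finset.sum_congr rfl fun j _ => ?_
  rw [hermiteVec, ← sq, hermiteFn_zero_sq]

theorem gapS_zero (m : ℕ) : gapS m 0 = gapR m 0 := by rw [gapS, gapR, neg_zero]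

theorem tendsto_gapR_zero :
    Tendsto (fun m : ℕ => gapR m 0 / ladder (m + 1)) atTop (𝓝 ((Real.pi⁻¹ : ℝ) : ℂ)) := by
  have h := ((tendsto_hermiteSqZero.div_const 2).sqrt)
  have h1 : √(2 / Real.pi ^ 2 / 2) = Real.pi⁻¹ := by
    rw [div_div, mul_comm, ← div_div, div_self two_ne_zero, one_div, ← inv_pow,
      Real.sqrt_sq (inv_nonneg.mpr Real.pi_pos.le)]
  rw [h1] at h
  refine (Complex.continuous_ofReal.tendsto _ |>.comp h).congr fun m => ?_
  have he : 0 ≤ hermiteSqZero m + hermiteSqZero (m + 1) :=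
    add_nonneg (hermiteSqZero_nonneg _) (hermiteSqZero_nonneg _)
  rw [gapR_zero, ladder, ← Complex.ofReal_div]
  simp only [Function.comp_apply]
  congr 1
  have hm : (0 : ℝ) < (m : ℝ) + 1 := by positivity
  rw [Real.sqrt_eq_iff_mul_self_eq (by positivity) (by positivity), div_mul_div_comm,
    Real.mul_self_sqrt (by positivity)]
  push_cast
  field_simp

/-! ### Bounds -/

/-- Along the ray from 0 to z the pair of consecutive Hermite functions solves a closed linear
system, so Grönwall's inequality applies. At z = t/√(2n) the exponent stays bounded for j < n. -/
theorem norm_hermiteFn_sq_le (j : ℕ) (z : ℂ) :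
    ‖hermiteFn j z‖ ^ 2 ≤ (hermiteSqZero j + hermiteSqZero (j + 1))
      * Real.exp (‖z‖ * (‖z‖ + ‖ladder (j + 1)‖)) ^ 2 := by
  set K : ℝ := ‖z‖ * (‖z‖ + ‖ladder (j + 1)‖) with hK
  have hd : ∀ r : ℝ, HasDerivAt (fun r : ℝ => (hermiteFn j (r * z), hermiteFn (j + 1) (r * z)))
      (((r * z) * hermiteFn j (r * z) - ladder (j + 1) * hermiteFn (j + 1) (r * z)) * z,
        (-(r * z) * hermiteFn (j + 1) (r * z) + ladder (j + 1) * hermiteFn j (r * z)) * z) r :=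
    fun r => by
      have hl : HasDerivAt (fun r : ℝ => (r : ℂ) * z) z r := by
        simpa using (Complex.ofRealCLM.hasDerivAt (x := r)).mul_const z
      have h1 := (hasDerivAt_hermiteFn_raise j (r * z)).comp r hl
      have h2 := (hasDerivAt_hermiteFn_lower (j + 1) (r * z)).comp r hl
      rw [Nat.add_sub_cancel] at h2
      exact h1.prodMk h2
  have hg := norm_le_gronwallBound_of_norm_deriv_right_le (a := 0) (b := 1) (K := K) (ε := 0)
    (fun r _ => (hd r).continuousAt.continuousWithinAt)
    (fun r _ => (hd r).hasDerivWithinAt) le_rfl (fun r hr => ?_) 1 (by simp)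
  · rw [gronwallBound_ε0] at hg
    simp only [Complex.ofReal_one, one_mul, Complex.ofReal_zero, zero_mul, sub_zero, mul_one] at hg
    have h1 : ‖hermiteFn j z‖ ≤ ‖(hermiteFn j 0, hermiteFn (j + 1) 0)‖ * Real.exp K :=
      (norm_fst_le (hermiteFn j z, hermiteFn (j + 1) z)).trans hg
    refine (pow_le_pow_left₀ (norm_nonneg _) h1 2).trans ?_
    rw [mul_pow]
    refine mul_le_mul_of_nonneg_right ?_ (by positivity)
    rw [Prod.norm_def]
    rcases max_choice ‖hermiteFn j 0‖ ‖hermiteFn (j + 1) 0‖ with h | h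
    · simp only [h]
      rw [norm_hermiteFn_zero_sq]
      exact le_add_of_nonneg_right (hermiteSqZero_nonneg _)
    · simp only [h]
      rw [norm_hermiteFn_zero_sq]
      exact le_add_of_nonneg_left (hermiteSqZero_nonneg _)
  · set a := hermiteFn j (r * z)
    set b := hermiteFn (j + 1) (r * z)
    have hrz : ‖(r : ℂ) * z‖ ≤ ‖z‖ := by
      rw [norm_mul, Complex.norm_real, Real.norm_of_nonneg hr.1]
      exact mul_le_of_le_one_left (norm_nonneg _) hr.2.le
    have ha : ‖a‖ ≤ ‖(a, b)‖ := norm_fst_le (a, b)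
    have hb : ‖b‖ ≤ ‖(a, b)‖ := norm_snd_le (a, b)
    have h0 := norm_nonneg (a, b)
    have key : ∀ x y : ℂ, ‖x‖ ≤ ‖(a, b)‖ → ‖y‖ ≤ ‖(a, b)‖ →
        ‖(r * z) * x‖ + ‖ladder (j + 1) * y‖ ≤ (‖z‖ + ‖ladder (j + 1)‖) * ‖(a, b)‖ :=
      fun x y hx hy => by
        rw [norm_mul, norm_mul (ladder _), add_mul]
        exact add_le_add (mul_le_mul hrz hx (norm_nonneg _) (norm_nonneg _))
          (mul_le_mul_of_nonneg_left hy (norm_nonneg _))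
    rw [add_zero]
    refine norm_prod_le_iff.mpr ⟨?_, ?_⟩
    · change ‖(r * z * a - ladder (j + 1) * b) * z‖ ≤ K * ‖(a, b)‖
      rw [norm_mul, mul_comm _ ‖z‖, hK, mul_assoc ‖z‖]
      exact mul_le_mul_of_nonneg_left ((norm_sub_le _ _).trans (key a b ha hb)) (norm_nonneg _)
    · change ‖(-(r * z) * b + ladder (j + 1) * a) * z‖ ≤ K * ‖(a, b)‖
      rw [norm_mul, mul_comm _ ‖z‖, hK, mul_assoc ‖z‖]
      refine mul_le_mul_of_nonneg_left ((norm_add_le _ _).trans ?_) (norm_nonneg _)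
      rw [neg_mul, norm_neg]
      exact key b a hb ha

-- The left side is the product of the eigenvalues μ of AA*, and μ ≤ exp(μ - 1). Subtracting n in
-- the exponent cancels the contribution of the identity when A = 1 - G, which makes the bound
-- uniform in the size.
open scoped ComplexOrder in
theorem norm_det_sq_le {n : ℕ} (A : Matrix (Fin n) (Fin n) ℂ) :
    ‖A.det‖ ^ 2 ≤ Real.exp (∑ i, ∑ j, ‖A i j‖ ^ 2 - n) := by
  have hpos := Matrix.posSemidef_self_mul_conjTranspose A
  have hdet : ((‖A.det‖ ^ 2 : ℝ) : ℂ) = (A * A.conjTranspose).det := by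
    rw [Matrix.det_mul, Matrix.det_conjTranspose, Complex.star_def, Complex.mul_conj,
      Complex.normSq_eq_norm_sq]
  have htr : ((∑ i, ∑ j, ‖A i j‖ ^ 2 : ℝ) : ℂ) = (A * A.conjTranspose).trace := by
    rw [Matrix.trace]
    push_cast
    refine Finset.sum_congr rfl fun i _ => ?_
    rw [Matrix.diag_apply, Matrix.mul_apply]
    refine Finset.sum_congr rfl fun j _ => ?_
    rw [Matrix.conjTranspose_apply, Complex.star_def, Complex.mul_conj, Complex.normSq_eq_norm_sq]
    push_cast
    rfl
  have hH := hpos.isHermitian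
  rw [hH.det_eq_prod_eigenvalues] at hdet
  rw [hH.trace_eq_sum_eigenvalues] at htr
  have hdet' : ‖A.det‖ ^ 2 = ∏ i, hH.eigenvalues i :=
    Complex.ofReal_injective (by rw [hdet, Complex.ofReal_prod]; rfl)
  have htr' : ∑ i, ∑ j, ‖A i j‖ ^ 2 = ∑ i, hH.eigenvalues i :=
    Complex.ofReal_injective (by rw [htr, Complex.ofReal_sum]; rfl)
  rw [hdet', htr']
  have h1 : (∑ i, hH.eigenvalues i) - n = ∑ i, (hH.eigenvalues i - 1) := by
    rw [Finset.sum_sub_distrib]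
    simp
  rw [h1, Real.exp_sum]
  refine Finset.prod_le_prod (fun i _ => hpos.eigenvalues_nonneg i) fun i _ => ?_
  have := Real.add_one_le_exp (hH.eigenvalues i - 1)
  linarith

theorem norm_det_one_sub_sq_le {n : ℕ} (G : Matrix (Fin n) (Fin n) ℂ) (b : Fin n → ℝ)
    (hb : ∀ i, 0 ≤ b i) (hG : ∀ i j, ‖G i j‖ ≤ √(b i * b j)) :
    ‖(1 - G).det‖ ^ 2 ≤ Real.exp (2 * ∑ i, b i + (∑ i, b i) ^ 2) := by
  refine (norm_det_sq_le _).trans (Real.exp_le_exp.mpr ?_)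
  have h1 : ∀ i j, ‖(1 - G) i j‖ ^ 2 ≤ (if i = j then 1 + 2 * b i else 0) + b i * b j :=
    fun i j => by
      have hsq : ‖G i j‖ ^ 2 ≤ b i * b j := by
        have := pow_le_pow_left₀ (norm_nonneg _) (hG i j) 2
        rwa [Real.sq_sqrt (mul_nonneg (hb i) (hb j))] at this
      by_cases hij : i = j
      · subst hij
        have h2 := hG i i
        rw [Real.sqrt_mul_self (hb i)] at h2
        have h3 : ‖(1 - G) i i‖ ≤ 1 + ‖G i i‖ := by
          rw [Matrix.sub_apply, Matrix.one_apply_eq]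
          exact (norm_sub_le _ _).trans (by simp)
        have h4 := norm_nonneg ((1 - G) i i)
        have h5 := norm_nonneg (G i i)
        simp only [if_true]
        nlinarith
      · rw [if_neg hij, Matrix.sub_apply, Matrix.one_apply_ne hij, zero_sub, norm_neg, zero_add]
        exact hsq
  have h2 : ∑ i, ∑ j, ‖(1 - G) i j‖ ^ 2
      ≤ ∑ i, ∑ j, ((if i = j then 1 + 2 * b i else 0) + b i * b j) :=
    Finset.sum_le_sum fun i _ => Finset.sum_le_sum fun j _ => h1 i j
  have h3 : ∑ i, ∑ j, ((if i = j then 1 + 2 * b i else 0) + b i * b j)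
      = n + 2 * ∑ i, b i + (∑ i, b i) ^ 2 := by
    rw [sq, Finset.sum_mul_sum]
    simp only [Finset.sum_add_distrib, Finset.sum_ite_eq, Finset.mem_univ, if_true,
      ← Finset.mul_sum]
    simp
  linarith

theorem norm_gapGram_le (n : ℕ) (z : ℂ) (i j : Fin n) :
    ‖gapGram n z i j‖ ≤ √((2 * ‖z‖ * ((hermiteSqZero i + hermiteSqZero (i + 1))
      * Real.exp (‖z‖ * (‖z‖ + ‖ladder n‖)) ^ 2)) *
      (2 * ‖z‖ * ((hermiteSqZero j + hermiteSqZero (j + 1))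
      * Real.exp (‖z‖ * (‖z‖ + ‖ladder n‖)) ^ 2))) := by
  set E := Real.exp (‖z‖ * (‖z‖ + ‖ladder n‖)) with hE
  have hlad : ∀ i : Fin n, ‖ladder (i + 1)‖ ≤ ‖ladder n‖ := fun i => by
    rw [ladder, ladder, Complex.norm_real, Complex.norm_real, Real.norm_of_nonneg
      (Real.sqrt_nonneg _), Real.norm_of_nonneg (Real.sqrt_nonneg _)]
    refine Real.sqrt_le_sqrt ?_
    have : ((i + 1 : ℕ) : ℝ) ≤ n := by exact_mod_cast i.isLt
    linarith
  have hb : ∀ (i : Fin n) (w : ℂ), ‖w‖ ≤ ‖z‖ → ‖hermiteFn i w‖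
      ≤ √((hermiteSqZero i + hermiteSqZero (i + 1)) * E ^ 2) := fun i w hw => by
    refine Real.le_sqrt_of_sq_le ((norm_hermiteFn_sq_le i w).trans ?_)
    refine mul_le_mul_of_nonneg_left (pow_le_pow_left₀ (Real.exp_pos _).le
      (Real.exp_le_exp.mpr ?_) 2) (add_nonneg (hermiteSqZero_nonneg _) (hermiteSqZero_nonneg _))
    exact mul_le_mul hw (add_le_add hw (hlad i)) (by positivity) (norm_nonneg _)
  have h := norm_symIntegral_le (differentiable_hermiteFn_mul i j) (z := z)
    (C := √((hermiteSqZero i + hermiteSqZero (i + 1)) * E ^ 2)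
      * √((hermiteSqZero j + hermiteSqZero (j + 1)) * E ^ 2)) fun w hw => by
    rw [norm_mul]
    exact mul_le_mul (hb i w hw) (hb j w hw) (norm_nonneg _) (Real.sqrt_nonneg _)
  refine h.trans (le_of_eq ?_)
  have hi : ∀ i : Fin n, 0 ≤ (hermiteSqZero i + hermiteSqZero (i + 1)) * E ^ 2 := fun i =>
    mul_nonneg (add_nonneg (hermiteSqZero_nonneg _) (hermiteSqZero_nonneg _)) (sq_nonneg _)
  rw [← Real.sqrt_mul (hi i), mul_mul_mul_comm (2 * ‖z‖) _ (2 * ‖z‖),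
    Real.sqrt_mul (by positivity : 0 ≤ 2 * ‖z‖ * (2 * ‖z‖)), Real.sqrt_mul_self (by positivity)]

/-- The scaled gap determinants are bounded on bounded sets, uniformly in `n`. -/
theorem exists_norm_gapDet_le (A : ℝ) :
    ∃ M : ℝ, ∀ (m : ℕ) (t : ℂ), ‖t‖ ≤ A → ‖gapDet (m + 1) (t / ladder (m + 1))‖ ≤ M := by
  obtain ⟨X, hX⟩ := tendsto_hermiteSqZero.bddAbove_range
  have hX' : ∀ m : ℕ, ((m : ℝ) + 1) * (hermiteSqZero m + hermiteSqZero (m + 1)) ^ 2 ≤ X :=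
    fun m => hX ⟨m, rfl⟩
  have hX0 : 0 ≤ X := le_trans (by positivity) (hX' 0)
  -- `Y` bounds the sum of the `b i`: the squares at the origin sum to at most 2√X·`lam`, this
  -- growth is absorbed by ‖z‖·`lam` ≤ A, and the Grönwall exponent is at most A(A + 1).
  set Y : ℝ := 2 * A * (2 * √X * Real.exp (A * (A + 1)) ^ 2) with hY
  refine ⟨√(Real.exp (2 * Y + Y ^ 2)), fun m t ht => Real.le_sqrt_of_sq_le ?_⟩
  have hA : 0 ≤ A := (norm_nonneg t).trans ht
  set z := t / ladder (m + 1) with hz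
  have hlam : ‖ladder (m + 1)‖ = √(2 * ((m : ℝ) + 1)) := by
    rw [ladder, Complex.norm_real, Real.norm_of_nonneg (Real.sqrt_nonneg _)]
    push_cast
    rfl
  set lam := √(2 * ((m : ℝ) + 1)) with hlamdef
  have hlam1 : 1 ≤ lam := by
    rw [hlamdef, Real.one_le_sqrt]
    have : (0 : ℝ) ≤ m := Nat.cast_nonneg m
    linarith
  have hzl : ‖z‖ * lam ≤ A := by
    rw [hz, norm_div, hlam, div_mul_cancel₀ _ (by positivity)]
    exact ht
  have hzA : ‖z‖ ≤ A := le_trans (le_mul_of_one_le_right (norm_nonneg _) hlam1) hzl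
  set b : Fin (m + 1) → ℝ := fun i => 2 * ‖z‖ * ((hermiteSqZero i + hermiteSqZero (i + 1))
      * Real.exp (‖z‖ * (‖z‖ + ‖ladder (m + 1)‖)) ^ 2) with hbdef
  have hb0 : ∀ i, 0 ≤ b i := fun i => mul_nonneg (by positivity)
    (mul_nonneg (add_nonneg (hermiteSqZero_nonneg _) (hermiteSqZero_nonneg _)) (sq_nonneg _))
  have hs : ∀ k : ℕ, ((k : ℝ) + 1) * (hermiteSqZero k + hermiteSqZero (k + 1))
      ≤ √X * √((k : ℝ) + 1) := fun k => by
    rw [← Real.sqrt_mul hX0]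
    refine Real.le_sqrt_of_sq_le ?_
    have hk : (0 : ℝ) ≤ (k : ℝ) + 1 := by positivity
    have := mul_le_mul_of_nonneg_right (hX' k) hk
    nlinarith
  have hsum : ∑ i : Fin (m + 1), (hermiteSqZero i + hermiteSqZero (i + 1)) ≤ 2 * √X * lam := by
    rw [Finset.sum_add_distrib, Fin.sum_univ_eq_sum_range hermiteSqZero,
      Fin.sum_univ_eq_sum_range (fun i => hermiteSqZero (i + 1)), sum_hermiteSqZero]
    have h1 := sum_hermiteSqZero (m + 1)
    rw [Finset.sum_range_succ'] at h1
    have h2 := hs m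
    have h3 := hs (m + 1)
    have h4 := hermiteSqZero_nonneg 0
    have h5 : √((m : ℝ) + 1) ≤ lam := Real.sqrt_le_sqrt (by linarith [(Nat.cast_nonneg m : (0 : ℝ) ≤ m)])
    have h6 : √(((m + 1 : ℕ) : ℝ) + 1) ≤ lam := by
      refine Real.sqrt_le_sqrt ?_
      push_cast
      linarith [(Nat.cast_nonneg m : (0 : ℝ) ≤ m)]
    have h7 := mul_le_mul_of_nonneg_left h5 (Real.sqrt_nonneg X)
    have h8 := mul_le_mul_of_nonneg_left h6 (Real.sqrt_nonneg X)
    linarith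
  have hbs : ∑ i, b i ≤ Y := by
    have h1 : ∑ i, b i = 2 * ‖z‖ * ((∑ i : Fin (m + 1), (hermiteSqZero i + hermiteSqZero (i + 1)))
        * Real.exp (‖z‖ * (‖z‖ + ‖ladder (m + 1)‖)) ^ 2) := by
      rw [hbdef, Finset.sum_mul, Finset.mul_sum]
    have hE : Real.exp (‖z‖ * (‖z‖ + ‖ladder (m + 1)‖)) ≤ Real.exp (A * (A + 1)) := by
      refine Real.exp_le_exp.mpr ?_
      rw [hlam, mul_add, mul_add, mul_one]
      exact add_le_add (mul_le_mul hzA hzA (norm_nonneg _) hA) hzl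
    rw [h1, hY]
    calc 2 * ‖z‖ * ((∑ i : Fin (m + 1), (hermiteSqZero i + hermiteSqZero (i + 1)))
        * Real.exp (‖z‖ * (‖z‖ + ‖ladder (m + 1)‖)) ^ 2)
        ≤ 2 * ‖z‖ * ((2 * √X * lam) * Real.exp (A * (A + 1)) ^ 2) := by gcongr
      _ = 2 * (‖z‖ * lam) * (2 * √X * Real.exp (A * (A + 1)) ^ 2) := by ring
      _ ≤ 2 * A * (2 * √X * Real.exp (A * (A + 1)) ^ 2) := by gcongr
  refine (norm_det_one_sub_sq_le _ b hb0 (norm_gapGram_le (m + 1) z)).trans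
    (Real.exp_le_exp.mpr ?_)
  have h0 : 0 ≤ ∑ i, b i := Finset.sum_nonneg fun i _ => hb0 i
  gcongr

/-! ### Taylor series at the origin -/

/-- The Taylor series at the origin. -/
noncomputable def taylorAtZero (f : ℂ → ℂ) : PowerSeries ℂ :=
  PowerSeries.mk fun k => iteratedDeriv k f 0 / k.factorial

theorem taylorAtZero_congr {f g : ℂ → ℂ} (h : f =ᶠ[𝓝 0] g) : taylorAtZero f = taylorAtZero g := by
  ext k
  simp only [taylorAtZero, PowerSeries.coeff_mk, h.iteratedDeriv_eq k]

theorem taylorAtZero_mul {f g : ℂ → ℂ} (hf : AnalyticAt ℂ f 0) (hg : AnalyticAt ℂ g 0) :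
    taylorAtZero (f * g) = taylorAtZero f * taylorAtZero g := by
  ext k
  simp only [taylorAtZero, PowerSeries.coeff_mk, PowerSeries.coeff_mul,
    iteratedDeriv_mul hf.contDiffAt hg.contDiffAt,
    Finset.Nat.sum_antidiagonal_eq_sum_range_succ_mk, Finset.sum_div]
  refine Finset.sum_congr rfl fun i hi => ?_
  rw [Nat.cast_choose _ (Nat.lt_succ_iff.mp (Finset.mem_range.mp hi))]
  field_simp [Nat.factorial_ne_zero]

theorem taylorAtZero_add {f g : ℂ → ℂ} (hf : AnalyticAt ℂ f 0) (hg : AnalyticAt ℂ g 0) :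
    taylorAtZero (f + g) = taylorAtZero f + taylorAtZero g := by
  ext k
  simp only [taylorAtZero, PowerSeries.coeff_mk, map_add,
    iteratedDeriv_add hf.contDiffAt hg.contDiffAt, add_div]

theorem taylorAtZero_sub {f g : ℂ → ℂ} (hf : AnalyticAt ℂ f 0) (hg : AnalyticAt ℂ g 0) :
    taylorAtZero (f - g) = taylorAtZero f - taylorAtZero g := by
  ext k
  simp only [taylorAtZero, PowerSeries.coeff_mk, map_sub,
    iteratedDeriv_sub hf.contDiffAt hg.contDiffAt, sub_div]

theorem taylorAtZero_const (c : ℂ) : taylorAtZero (fun _ => c) = PowerSeries.C c := by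
  ext k
  simp only [taylorAtZero, PowerSeries.coeff_mk, PowerSeries.coeff_C, iteratedDeriv_const]
  cases k <;> simp

theorem taylorAtZero_deriv (f : ℂ → ℂ) :
    taylorAtZero (deriv f) = PowerSeries.derivative ℂ (taylorAtZero f) := by
  ext k
  simp only [taylorAtZero, PowerSeries.coeff_mk, PowerSeries.coeff_derivative, iteratedDeriv_succ',
    Nat.factorial_succ]
  push_cast
  have : (k.factorial : ℂ) ≠ 0 := Nat.cast_ne_zero.mpr k.factorial_ne_zero
  have : (k : ℂ) + 1 ≠ 0 := Nat.cast_add_one_ne_zero k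
  field_simp

theorem taylorAtZero_id : taylorAtZero (fun z => z) = PowerSeries.X := by
  ext k
  simp only [taylorAtZero, PowerSeries.coeff_mk, PowerSeries.coeff_X]
  match k with
  | 0 => simp
  | 1 => simp
  | k + 2 =>
    have h : deriv (fun z : ℂ => z) = fun _ => 1 := by ext; simp
    rw [iteratedDeriv_succ', h, iteratedDeriv_const]
    simp

/-! ### Recursive convergence of Taylor coefficients. -/

/-- All coefficients up to order `k` of a sequence of power series converge. -/
def CoeffsConverge (A : ℕ → PowerSeries ℂ) (k : ℕ) : Prop :=
  ∀ i ≤ k, ∃ l, Tendsto (fun n => PowerSeries.coeff i (A n)) atTop (𝓝 l)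

namespace CoeffsConverge

variable {A B : ℕ → PowerSeries ℂ} {k : ℕ}

theorem mono {l : ℕ} (h : CoeffsConverge A k) (hl : l ≤ k) : CoeffsConverge A l :=
  fun i hi => h i (hi.trans hl)

theorem add (hA : CoeffsConverge A k) (hB : CoeffsConverge B k) :
    CoeffsConverge (fun n => A n + B n) k := fun i hi => by
  obtain ⟨a, ha⟩ := hA i hi
  obtain ⟨b, hb⟩ := hB i hi
  exact ⟨a + b, by simpa using ha.add hb⟩

theorem sub (hA : CoeffsConverge A k) (hB : CoeffsConverge B k) :
    CoeffsConverge (fun n => A n - B n) k := fun i hi => by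
  obtain ⟨a, ha⟩ := hA i hi
  obtain ⟨b, hb⟩ := hB i hi
  exact ⟨a - b, by simpa using ha.sub hb⟩

theorem mul (hA : CoeffsConverge A k) (hB : CoeffsConverge B k) :
    CoeffsConverge (fun n => A n * B n) k := fun i hi => by
  simp only [PowerSeries.coeff_mul]
  choose a ha using fun j : Fin (k + 1) => hA j (Nat.lt_succ_iff.mp j.isLt)
  choose b hb using fun j : Fin (k + 1) => hB j (Nat.lt_succ_iff.mp j.isLt)
  refine ⟨∑ p ∈ Finset.HasAntidiagonal.antidiagonal i, a (Fin.ofNat (k + 1) p.1) * b (Fin.ofNat (k + 1) p.2),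
    tendsto_finsetSum _ fun p hp => ?_⟩
  have hp' := Finset.HasAntidiagonal.mem_antidiagonal.mp hp
  have h1 := ha (Fin.ofNat (k + 1) p.1)
  have h2 := hb (Fin.ofNat (k + 1) p.2)
  rw [Fin.val_ofNat, Nat.mod_eq_of_lt (by omega)] at h1 h2
  exact h1.mul h2

theorem const {c : ℕ → ℂ} {l : ℂ} (h : Tendsto c atTop (𝓝 l)) :
    CoeffsConverge (fun n => PowerSeries.C (c n)) k := fun i _ => by
  simp only [PowerSeries.coeff_C]
  by_cases hi : i = 0
  · exact ⟨l, by simpa [hi] using h⟩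
  · exact ⟨0, by simp [hi]⟩

theorem X_mul (hA : CoeffsConverge A k) :
    CoeffsConverge (fun n => PowerSeries.X * A n) (k + 1) := fun i hi => by
  cases i with
  | zero => exact ⟨0, by simp⟩
  | succ i => simpa [PowerSeries.coeff_succ_X_mul] using hA i (by omega)

theorem X_mul_self (hA : CoeffsConverge A k) :
    CoeffsConverge (fun n => PowerSeries.X * A n) k := (X_mul hA).mono (Nat.le_succ k)

end CoeffsConverge

/-- The finite `n` differential equations determine the convergence of all Taylor coefficients. -/
theorem coeffsConverge_of_equations {A B : ℕ → PowerSeries ℂ} {η : ℕ → ℂ} {ρ : ℂ}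
    (hη : Tendsto η atTop (𝓝 0)) (hρ : ρ ≠ 0)
    (hA0 : Tendsto (fun n => PowerSeries.coeff 0 (A n)) atTop (𝓝 ρ))
    (hAB : ∀ n, PowerSeries.coeff 0 (B n) = PowerSeries.coeff 0 (A n))
    (h1 : ∀ n, PowerSeries.derivative ℂ (A n)
      = PowerSeries.C 2 * (B n * B n) - PowerSeries.C (η n) * (PowerSeries.X * B n))
    (h2 : ∀ n, (A n + PowerSeries.X * (PowerSeries.C 2 * (B n * B n)
        + PowerSeries.C (η n) * (PowerSeries.X * B n))) ^ 2
      - (B n + PowerSeries.X * PowerSeries.derivative ℂ (B n)) ^ 2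
      = PowerSeries.X * ((PowerSeries.C 4 + PowerSeries.C 8 * (PowerSeries.C (η n)
        * (PowerSeries.X * B n))) * (PowerSeries.X * (B n * B n)))) (k : ℕ) :
    CoeffsConverge A k ∧ CoeffsConverge B k := by
  induction k with
  | zero =>
    have hA : CoeffsConverge A 0 := fun i hi => by
      rw [Nat.le_zero.mp hi]
      exact ⟨ρ, hA0⟩
    refine ⟨hA, fun i hi => ?_⟩
    rw [Nat.le_zero.mp hi]
    simp_rw [hAB]
    exact ⟨ρ, hA0⟩
  | succ k ih =>
    obtain ⟨hA, hB⟩ := ih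
    have hηB : CoeffsConverge (fun n => PowerSeries.C (η n) * (PowerSeries.X * B n)) k :=
      (CoeffsConverge.const hη).mul hB.X_mul_self
    have h2B : CoeffsConverge (fun n => PowerSeries.C 2 * (B n * B n)) k :=
      (CoeffsConverge.const tendsto_const_nhds).mul (hB.mul hB)
    have hA' : CoeffsConverge A (k + 1) := fun i hi => by
      -- The new coefficient of `A` comes from the first equation, whose right side involves `B`
      -- only up to order k.
      rcases Nat.lt_or_ge i (k + 1) with h | h
      · exact hA i (Nat.lt_succ_iff.mp h)
      · obtain rfl : i = k + 1 := le_antisymm hi h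
        obtain ⟨l, hl⟩ := (h2B.sub hηB) k le_rfl
        refine ⟨l / (k + 1), (hl.div_const ((k : ℂ) + 1)).congr fun n => ?_⟩
        beta_reduce
        rw [← h1, PowerSeries.coeff_derivative, mul_div_cancel_right₀ _ (Nat.cast_add_one_ne_zero k)]
    refine ⟨hA', fun i hi => ?_⟩
    rcases Nat.lt_or_ge i (k + 1) with h | h
    · exact hB i (Nat.lt_succ_iff.mp h)
    obtain rfl : i = k + 1 := le_antisymm hi h
    set W : ℕ → PowerSeries ℂ := fun n => PowerSeries.X * (PowerSeries.C 2 * (B n * B n)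
        + PowerSeries.C (η n) * (PowerSeries.X * B n)) with hW
    set V : ℕ → PowerSeries ℂ := fun n => B n + PowerSeries.X * PowerSeries.derivative ℂ (B n)
      with hV
    have hVc : ∀ n i, PowerSeries.coeff i (V n) = (i + 1) * PowerSeries.coeff i (B n) :=
      fun n i => by
        rw [hV]
        cases i with
        | zero => simp
        | succ i =>
          simp only [map_add, PowerSeries.coeff_succ_X_mul, PowerSeries.coeff_derivative]
          push_cast
          ring
    have hWc : CoeffsConverge W (k + 1) := (h2B.add hηB).X_mul
    have hW0 : ∀ n, PowerSeries.coeff 0 (W n) = 0 := fun n => by simp [hW]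
    have hVk : CoeffsConverge V k := fun i hi => by
      obtain ⟨l, hl⟩ := hB i hi
      simp_rw [hVc]
      exact ⟨_, hl.const_mul _⟩
    have hU : CoeffsConverge (fun n => A n + W n) (k + 1) := hA'.add hWc
    -- Factor the second equation as (A + W - V)(A + W + V). The first factor has constant term 0
    -- and the second 2A(0), nonzero in the limit. So the coefficient of order k + 1 determines that
    -- of A + W - V, and hence that of `B`, by coefficients already known to converge.
    have hC : CoeffsConverge (fun n => A n + W n - V n) k := (hU.mono (Nat.le_succ k)).sub hVk
    have hE : CoeffsConverge (fun n => A n + W n + V n) k := (hU.mono (Nat.le_succ k)).add hVk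
    have hR : CoeffsConverge (fun n => PowerSeries.X * ((PowerSeries.C 4 + PowerSeries.C 8 *
        (PowerSeries.C (η n) * (PowerSeries.X * B n))) * (PowerSeries.X * (B n * B n)))) (k + 1) :=
      ((((CoeffsConverge.const tendsto_const_nhds).add
        ((CoeffsConverge.const tendsto_const_nhds).mul hηB))).mul (hB.mul hB).X_mul_self).X_mul
    obtain ⟨r, hr⟩ := hR (k + 1) le_rfl
    have hmid : ∃ l, Tendsto (fun n => ∑ j ∈ Finset.range k,
        PowerSeries.coeff (j + 1) (A n + W n - V n)
          * PowerSeries.coeff (k + 1 - (j + 1)) (A n + W n + V n)) atTop (𝓝 l) := by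
      choose c hc using fun j : Fin k => hC (j + 1) (by omega)
      choose e he using fun j : Fin k => hE (k + 1 - (j + 1)) (by omega)
      refine ⟨∑ j : Fin k, c j * e j, ?_⟩
      simp_rw [← Fin.sum_univ_eq_sum_range (fun j => PowerSeries.coeff (j + 1) (A _ + W _ - V _)
        * PowerSeries.coeff (k + 1 - (j + 1)) (A _ + W _ + V _))]
      exact tendsto_finsetSum _ fun j _ => (hc j).mul (he j)
    obtain ⟨s, hs⟩ := hmid
    obtain ⟨u, hu⟩ := hU (k + 1) le_rfl
    have hC0 : ∀ n, PowerSeries.coeff 0 (A n + W n - V n) = 0 := fun n => by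
      rw [map_sub, map_add, hW0, hVc, hAB]
      simp
    have hE0 : ∀ n, PowerSeries.coeff 0 (A n + W n + V n) = 2 * PowerSeries.coeff 0 (A n) :=
      fun n => by
        rw [map_add, map_add, hW0, hVc, hAB]
        push_cast
        ring
    have hkey : ∀ n, PowerSeries.coeff (k + 1) (A n + W n - V n) * (2 * PowerSeries.coeff 0 (A n))
        = PowerSeries.coeff (k + 1) (PowerSeries.X * ((PowerSeries.C 4 + PowerSeries.C 8 *
        (PowerSeries.C (η n) * (PowerSeries.X * B n))) * (PowerSeries.X * (B n * B n))))
        - ∑ j ∈ Finset.range k, PowerSeries.coeff (j + 1) (A n + W n - V n)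
          * PowerSeries.coeff (k + 1 - (j + 1)) (A n + W n + V n) := fun n => by
      have h3 : (A n + W n - V n) * (A n + W n + V n) = PowerSeries.X * ((PowerSeries.C 4 +
          PowerSeries.C 8 * (PowerSeries.C (η n) * (PowerSeries.X * B n)))
          * (PowerSeries.X * (B n * B n))) := by
        rw [← h2 n]
        ring
      rw [← h3, PowerSeries.coeff_mul, Finset.Nat.sum_antidiagonal_eq_sum_range_succ_mk,
        Finset.sum_range_succ, Finset.sum_range_succ', hC0, Nat.sub_self, hE0]
      ring
    have hne : ∀ᶠ n in atTop, PowerSeries.coeff 0 (A n) ≠ 0 := hA0.eventually_ne hρ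
    have hlim := (hr.sub hs).div (hA0.const_mul 2) (mul_ne_zero two_ne_zero hρ)
    have hCk : Tendsto (fun n => PowerSeries.coeff (k + 1) (A n + W n - V n)) atTop
        (𝓝 ((r - s) / (2 * ρ))) := by
      refine hlim.congr' (hne.mono fun n hn => ?_)
      rw [Pi.div_apply, ← hkey, mul_div_cancel_right₀ _ (mul_ne_zero two_ne_zero hn)]
    refine ⟨_, ((hu.sub hCk).div_const ((((k + 1 : ℕ) : ℂ)) + 1)).congr fun n => ?_⟩
    rw [← map_sub, sub_sub_cancel, hVc,
      mul_div_cancel_left₀ _ (Nat.cast_add_one_ne_zero (k + 1))]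

theorem coeffsConverge_of_log_deriv {A D : ℕ → PowerSeries ℂ} {l : ℂ}
    (hA : ∀ k, CoeffsConverge A k)
    (hD0 : Tendsto (fun n => PowerSeries.coeff 0 (D n)) atTop (𝓝 l))
    (hD : ∀ n, PowerSeries.derivative ℂ (D n) = PowerSeries.C (-2) * (A n * D n)) (k : ℕ) :
    CoeffsConverge D k := by
  induction k with
  | zero =>
    intro i hi
    rw [Nat.le_zero.mp hi]
    exact ⟨l, hD0⟩
  | succ k ih =>
    intro i hi
    rcases Nat.lt_or_ge i (k + 1) with h | h
    · exact ih i (Nat.lt_succ_iff.mp h)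
    obtain rfl : i = k + 1 := le_antisymm hi h
    obtain ⟨l, hl⟩ := ((CoeffsConverge.const
      (tendsto_const_nhds (x := (-2 : ℂ)))).mul ((hA k).mul ih)) k le_rfl
    refine ⟨l / (k + 1), (hl.div_const ((k : ℂ) + 1)).congr fun n => ?_⟩
    beta_reduce
    rw [← hD, PowerSeries.coeff_derivative, mul_div_cancel_right₀ _ (Nat.cast_add_one_ne_zero k)]

/-- Locally bounded entire functions whose Taylor coefficients converge, converge locally
uniformly. -/
theorem exists_tendstoLocallyUniformlyOn_of_coeffsConverge {p : ℕ → ℂ → ℂ}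
    (hp : ∀ n, Differentiable ℂ (p n))
    (hb : ∀ A : ℝ, ∃ M : ℝ, ∀ n t, ‖t‖ ≤ A → ‖p n t‖ ≤ M)
    (hc : ∀ k, CoeffsConverge (fun n => taylorAtZero (p n)) k) :
    ∃ F : ℂ → ℂ, TendstoLocallyUniformlyOn p F atTop univ := by
  choose c hc using fun k => hc k k le_rfl
  simp only [taylorAtZero, PowerSeries.coeff_mk] at hc
  have hsum : ∀ n t, HasSum (fun k => iteratedDeriv k (p n) 0 / k.factorial * t ^ k) (p n t) :=
    fun n t => by
      refine (Complex.hasSum_taylorSeries_of_entire (hp n) 0 t).congr_fun fun k => ?_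
      simp only [sub_zero, smul_eq_mul]
      field_simp
  have hcoef : ∀ A : ℝ, 0 < A → ∃ M : ℝ, ∀ n k,
      ‖iteratedDeriv k (p n) 0 / k.factorial‖ ≤ M / A ^ k := fun A hA => by
    obtain ⟨M, hM⟩ := hb A
    refine ⟨M, fun n k => ?_⟩
    have h := Complex.norm_iteratedDeriv_le_of_forall_mem_sphere_norm_le k hA
      (hp n).diffContOnCl (fun z hz => hM n z (by simpa using (mem_sphere_zero_iff_norm.mp hz).le))
    have hk : (0 : ℝ) < k.factorial := Nat.cast_pos.mpr k.factorial_pos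
    rw [norm_div, Complex.norm_natCast, div_le_iff₀ hk]
    refine h.trans (le_of_eq ?_)
    ring
  refine ⟨fun t => ∑' k, c k * t ^ k, ?_⟩
  rw [Metric.tendstoLocallyUniformlyOn_iff]
  intro ε hε x _
  set A : ℝ := ‖x‖ + 1 with hA
  have hA0 : 0 < A := by positivity
  -- Cauchy estimates on the doubled radius give a geometric majorant on the disc of radius `A`, so
  -- dominated convergence applies to the series of coefficient differences.
  obtain ⟨M, hM⟩ := hcoef (2 * A) (by positivity)
  have hcM : ∀ k, ‖c k‖ ≤ M / (2 * A) ^ k := fun k =>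
    le_of_tendsto (hc k).norm (Eventually.of_forall fun n => hM n k)
  have hgeo : Summable fun k : ℕ => 2 * M * (1 / 2 : ℝ) ^ k :=
    (summable_geometric_of_lt_one (by norm_num) (by norm_num)).mul_left _
  have hbd : ∀ n k, ‖‖iteratedDeriv k (p n) 0 / k.factorial - c k‖ * A ^ k‖
      ≤ 2 * M * (1 / 2 : ℝ) ^ k := fun n k => by
    rw [norm_mul, norm_norm, Real.norm_of_nonneg (pow_nonneg hA0.le k)]
    have h1 := (norm_sub_le _ _).trans (add_le_add (hM n k) (hcM k))
    refine (mul_le_mul_of_nonneg_right h1 (pow_nonneg hA0.le k)).trans (le_of_eq ?_)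
    rw [mul_pow, one_div, inv_pow]
    field_simp
    ring
  have ht := tendsto_tsum_of_dominated_convergence (𝓕 := atTop) (g := fun _ => (0 : ℝ)) hgeo
    (fun k => by
      have := ((hc k).sub_const (c k)).norm.mul_const (A ^ k)
      simpa using this) (Eventually.of_forall hbd)
  rw [tsum_zero] at ht
  refine ⟨Metric.closedBall 0 A, mem_nhdsWithin_of_mem_nhds
    (Metric.closedBall_mem_nhds_of_mem (by simp [hA])), ?_⟩
  filter_upwards [ht.eventually_lt_const hε] with n hn y hy
  have hy' : ‖y‖ ≤ A := by simpa using hy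
  have hle : ∀ a : ℂ, ∀ k : ℕ, ‖a * y ^ k‖ ≤ ‖a‖ * A ^ k := fun a k => by
    rw [norm_mul, norm_pow]
    gcongr
  have hsc : Summable fun k => c k * y ^ k := by
    refine Summable.of_norm_bounded (g := fun k => M * (1 / 2 : ℝ) ^ k)
      ((summable_geometric_of_lt_one (by norm_num) (by norm_num)).mul_left _) fun k => ?_
    refine (hle _ k).trans ((mul_le_mul_of_nonneg_right (hcM k) (pow_nonneg hA0.le k)).trans
      (le_of_eq ?_))
    rw [mul_pow, one_div, inv_pow]
    field_simp
  refine lt_of_le_of_lt ?_ hn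
  rw [dist_comm, dist_eq_norm, ← (hsum n y).tsum_eq, ← (hsum n y).summable.tsum_sub hsc]
  have hsn : Summable fun k => ‖iteratedDeriv k (p n) 0 / k.factorial - c k‖ * A ^ k :=
    Summable.of_norm_bounded hgeo (hbd n)
  refine tsum_of_norm_bounded hsn.hasSum fun k => ?_
  rw [← sub_mul]
  exact hle _ k

/-! ### The scaled gap determinants -/

/-- The gap determinant in the bulk scaling. -/
noncomputable def scaledDet (m : ℕ) (t : ℂ) : ℂ := gapDet (m + 1) (t / ladder (m + 1))

/-- The diagonal resolvent kernel in the bulk scaling. -/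
noncomputable def scaledR (m : ℕ) (t : ℂ) : ℂ := gapR m (t / ladder (m + 1)) / ladder (m + 1)

/-- The antidiagonal resolvent kernel in the bulk scaling. -/
noncomputable def scaledS (m : ℕ) (t : ℂ) : ℂ := gapS m (t / ladder (m + 1)) / ladder (m + 1)

/-- The coefficient of the finite size corrections. -/
noncomputable def finiteSize (m : ℕ) : ℂ := (-1) ^ m / (m + 1)

theorem tendsto_finiteSize : Tendsto finiteSize atTop (𝓝 0) := by
  rw [tendsto_zero_iff_norm_tendsto_zero]
  refine tendsto_one_div_add_atTop_nhds_zero_nat.congr fun m => ?_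
  rw [finiteSize, norm_div, norm_pow, norm_neg, norm_one, one_pow]
  congr 1
  exact_mod_cast (Complex.norm_natCast (m + 1)).symm

theorem ladder_sq_mul_finiteSize (m : ℕ) : ladder (m + 1) ^ 2 * finiteSize m = 2 * (-1) ^ m := by
  have : (m : ℂ) + 1 ≠ 0 := Nat.cast_add_one_ne_zero m
  rw [ladder_sq, finiteSize]
  push_cast
  field_simp

theorem hasDerivAt_comp_div {f : ℂ → ℂ} {f' c t : ℂ} (hf : HasDerivAt f f' (t / c)) :
    HasDerivAt (fun t => f (t / c)) (f' / c) t := by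
  have h := hf.comp t ((hasDerivAt_id t).div_const c)
  exact h.congr_deriv (by ring)

theorem differentiable_scaledDet (m : ℕ) : Differentiable ℂ (scaledDet m) := fun _ =>
  (hasDerivAt_comp_div (differentiable_gapDet (m + 1) _).hasDerivAt).differentiableAt

theorem scaledDet_zero (m : ℕ) : scaledDet m 0 = 1 := by
  rw [scaledDet, zero_div, gapDet_zero]

section Equations

variable {m : ℕ} {t : ℂ} (ht : scaledDet m t ≠ 0)
include ht

theorem eventually_scaledDet_ne_zero : ∀ᶠ w in 𝓝 t, scaledDet m w ≠ 0 :=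
  (differentiable_scaledDet m t).continuousAt.eventually_ne ht

/-- By parity both endpoints contribute equally, whence the factor 2. -/
theorem hasDerivAt_scaledDet :
    HasDerivAt (scaledDet m) (-2 * (scaledR m t * scaledDet m t)) t := by
  refine (hasDerivAt_comp_div (hasDerivAt_gapDet ht)).congr_deriv ?_
  rw [gapForm_neg_neg, scaledR, scaledDet, gapR]
  ring

theorem hasDerivAt_scaledR :
    HasDerivAt (scaledR m) (2 * (scaledS m t * scaledS m t)
      - finiteSize m * (t * scaledS m t)) t := by
  refine ((hasDerivAt_comp_div (hasDerivAt_gapR ht)).div_const _).congr_deriv ?_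
  have hl := ladder_succ_ne_zero m
  have h := ladder_sq_mul_finiteSize m
  rw [scaledS]
  field_simp
  linear_combination t * gapS m (t / ladder (m + 1)) * h

theorem differentiableAt_scaledS : DifferentiableAt ℂ (scaledS m) t :=
  ((hasDerivAt_comp_div (differentiableAt_gapS ht).hasDerivAt).div_const _).differentiableAt

theorem scaledS_deriv_relation :
    (scaledR m t + t * (2 * (scaledS m t * scaledS m t)
        + finiteSize m * (t * scaledS m t))) ^ 2
      - (scaledS m t + t * deriv (scaledS m) t) ^ 2
      = t * ((4 + 8 * (finiteSize m * (t * scaledS m t))) * (t * (scaledS m t * scaledS m t))) := by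
  have hl := ladder_succ_ne_zero m
  have h := ladder_sq_mul_finiteSize m
  have hsq := ladder_sq (m + 1)
  push_cast at hsq
  have hS : deriv (scaledS m) t = deriv (gapS m) (t / ladder (m + 1)) / ladder (m + 1)
      / ladder (m + 1) :=
    ((hasDerivAt_comp_div (differentiableAt_gapS ht).hasDerivAt).div_const _).deriv
  have hE := gapS_deriv_relation ht
  have hf : finiteSize m = 2 * (-1) ^ m / ladder (m + 1) ^ 2 := by
    rw [← h]
    field_simp
  have h8 : (8 * ((m : ℂ) + 1)) = 4 * ladder (m + 1) ^ 2 := by rw [hsq]; ring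
  rw [h8] at hE
  rw [hS, hf, scaledR, scaledS]
  field_simp at hE ⊢
  linear_combination hE

end Equations

theorem eventually_scaledDet_ne_zero_zero (m : ℕ) : ∀ᶠ w in 𝓝 (0 : ℂ), scaledDet m w ≠ 0 :=
  eventually_scaledDet_ne_zero (by rw [scaledDet_zero]; exact one_ne_zero)

theorem analyticAt_scaledR_zero (m : ℕ) : AnalyticAt ℂ (scaledR m) 0 :=
  Complex.analyticAt_iff_eventually_differentiableAt.mpr
    ((eventually_scaledDet_ne_zero_zero m).mono fun _ hw => (hasDerivAt_scaledR hw).differentiableAt)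

theorem analyticAt_scaledS_zero (m : ℕ) : AnalyticAt ℂ (scaledS m) 0 :=
  Complex.analyticAt_iff_eventually_differentiableAt.mpr
    ((eventually_scaledDet_ne_zero_zero m).mono fun _ hw => differentiableAt_scaledS hw)

theorem analyticAt_scaledDet_zero (m : ℕ) : AnalyticAt ℂ (scaledDet m) 0 :=
  (differentiable_scaledDet m).analyticAt 0

theorem coeff_zero_taylorAtZero (f : ℂ → ℂ) : PowerSeries.coeff 0 (taylorAtZero f) = f 0 := by
  simp [taylorAtZero]

/-- R and S are known to be analytic only where the determinant does not vanish, a neighbourhood of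
0 that may depend on m. Comparing Taylor series at 0 avoids any common domain. -/
theorem coeffsConverge_scaledDet (k : ℕ) :
    CoeffsConverge (fun m => taylorAtZero (scaledDet m)) k := by
  have hid : AnalyticAt ℂ (fun z : ℂ => z) 0 := analyticAt_id
  have hc : ∀ c : ℂ, AnalyticAt ℂ (fun _ : ℂ => c) 0 := fun c => analyticAt_const
  have hR0 : Tendsto (fun m => PowerSeries.coeff 0 (taylorAtZero (scaledR m))) atTop
      (𝓝 ((Real.pi⁻¹ : ℝ) : ℂ)) := by
    simp_rw [coeff_zero_taylorAtZero, scaledR, zero_div]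
    exact tendsto_gapR_zero
  have h1 : ∀ m, PowerSeries.derivative ℂ (taylorAtZero (scaledR m))
      = PowerSeries.C 2 * (taylorAtZero (scaledS m) * taylorAtZero (scaledS m))
        - PowerSeries.C (finiteSize m) * (PowerSeries.X * taylorAtZero (scaledS m)) := fun m => by
    have hS := analyticAt_scaledS_zero m
    rw [← taylorAtZero_deriv, ← taylorAtZero_id, ← taylorAtZero_const, ← taylorAtZero_const,
      ← taylorAtZero_mul hS hS, ← taylorAtZero_mul (hc _) (hS.mul hS), ← taylorAtZero_mul hid hS,
      ← taylorAtZero_mul (hc _) (hid.mul hS),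
      ← taylorAtZero_sub ((hc _).mul (hS.mul hS)) ((hc _).mul (hid.mul hS))]
    exact taylorAtZero_congr ((eventually_scaledDet_ne_zero_zero m).mono fun w hw =>
      (hasDerivAt_scaledR hw).deriv)
  have h2 : ∀ m, (taylorAtZero (scaledR m) + PowerSeries.X * (PowerSeries.C 2 *
        (taylorAtZero (scaledS m) * taylorAtZero (scaledS m))
        + PowerSeries.C (finiteSize m) * (PowerSeries.X * taylorAtZero (scaledS m)))) ^ 2
      - (taylorAtZero (scaledS m)
        + PowerSeries.X * PowerSeries.derivative ℂ (taylorAtZero (scaledS m))) ^ 2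
      = PowerSeries.X * ((PowerSeries.C 4 + PowerSeries.C 8 * (PowerSeries.C (finiteSize m)
        * (PowerSeries.X * taylorAtZero (scaledS m)))) * (PowerSeries.X *
        (taylorAtZero (scaledS m) * taylorAtZero (scaledS m)))) := fun m => by
    have hS := analyticAt_scaledS_zero m
    have hR := analyticAt_scaledR_zero m
    have hS' := hS.deriv
    have hSS := hS.mul hS
    have hXS := hid.mul hS
    have hηXS := (hc (finiteSize m)).mul hXS
    have hin := ((hc 2).mul hSS).add hηXS
    have hL := hR.add (hid.mul hin)
    have hV := hS.add (hid.mul hS')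
    have hXSS := hid.mul hSS
    have h48 := (hc 4).add ((hc 8).mul hηXS)
    rw [← taylorAtZero_deriv, ← taylorAtZero_id, ← taylorAtZero_const, ← taylorAtZero_const,
      ← taylorAtZero_const, ← taylorAtZero_const, sq, sq,
      ← taylorAtZero_mul hS hS, ← taylorAtZero_mul (hc 2) hSS, ← taylorAtZero_mul hid hS,
      ← taylorAtZero_mul (hc (finiteSize m)) hXS, ← taylorAtZero_add ((hc 2).mul hSS) hηXS,
      ← taylorAtZero_mul hid hin, ← taylorAtZero_add hR (hid.mul hin), ← taylorAtZero_mul hL hL,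
      ← taylorAtZero_mul hid hS', ← taylorAtZero_add hS (hid.mul hS'), ← taylorAtZero_mul hV hV,
      ← taylorAtZero_sub (hL.mul hL) (hV.mul hV), ← taylorAtZero_mul (hc 8) hηXS,
      ← taylorAtZero_add (hc 4) ((hc 8).mul hηXS), ← taylorAtZero_mul hid hSS,
      ← taylorAtZero_mul h48 hXSS, ← taylorAtZero_mul hid (h48.mul hXSS)]
    refine taylorAtZero_congr ((eventually_scaledDet_ne_zero_zero m).mono fun w hw => ?_)
    have := scaledS_deriv_relation hw
    rw [sq, sq] at this
    exact this
  refine coeffsConverge_of_log_deriv (l := 1) (A := fun m => taylorAtZero (scaledR m))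
    (fun k => (coeffsConverge_of_equations tendsto_finiteSize (by simp [Real.pi_ne_zero]) hR0
      (fun m => ?_) h1 h2 k).1) ?_ (fun m => ?_) k
  · rw [coeff_zero_taylorAtZero, coeff_zero_taylorAtZero, scaledR, scaledS, zero_div, gapS_zero]
  · simp_rw [coeff_zero_taylorAtZero, scaledDet_zero]
    exact tendsto_const_nhds
  · have hR := analyticAt_scaledR_zero m
    have hD := analyticAt_scaledDet_zero m
    rw [← taylorAtZero_deriv, ← taylorAtZero_const, ← taylorAtZero_mul hR hD,
      ← taylorAtZero_mul (hc _) (hR.mul hD)]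
    exact taylorAtZero_congr ((eventually_scaledDet_ne_zero_zero m).mono fun w hw =>
      (hasDerivAt_scaledDet hw).deriv)

theorem exists_tendstoLocallyUniformlyOn_scaledDet :
    ∃ F : ℂ → ℂ, TendstoLocallyUniformlyOn scaledDet F atTop univ :=
  exists_tendstoLocallyUniformlyOn_of_coeffsConverge differentiable_scaledDet
    (fun A => exists_norm_gapDet_le A) coeffsConverge_scaledDet

/-! ### Passage to the limit -/

/-- Minus half the logarithmic derivative. -/
noncomputable def halfLogDeriv (p : ℂ → ℂ) (t : ℂ) : ℂ := -deriv p t / (2 * p t)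

theorem deriv_eventually_eq_halfLogDeriv {p : ℂ → ℂ} (hp : Differentiable ℂ p) {t : ℂ}
    (ht : p t ≠ 0) :
    ∀ᶠ w in 𝓝 t, DifferentiableAt ℂ (halfLogDeriv p) w ∧
      deriv p w = -2 * (halfLogDeriv p w * p w) := by
  filter_upwards [(hp t).continuousAt.eventually_ne ht] with w hw
  refine ⟨?_, ?_⟩
  · exact ((hp.contDiff (n := 2)).differentiable_deriv_two w).neg.div
      ((hp w).const_mul 2) (mul_ne_zero two_ne_zero hw)
  · rw [halfLogDeriv]
    field_simp

theorem differentiableAt_deriv_of_eventually {f : ℂ → ℂ} {t : ℂ}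
    (h : ∀ᶠ w in 𝓝 t, DifferentiableAt ℂ f w) : DifferentiableAt ℂ (deriv f) t :=
  (Complex.analyticAt_iff_eventually_differentiableAt.mpr h).deriv.differentiableAt

theorem deriv_halfLogDeriv {p : ℂ → ℂ} (hp : Differentiable ℂ p) {t : ℂ} (ht : p t ≠ 0) :
    deriv (halfLogDeriv p) t = (-deriv (deriv p) t / 2 - halfLogDeriv p t * deriv p t) / p t ∧
    deriv (deriv (halfLogDeriv p)) t = (-deriv (deriv (deriv p)) t / 2
      - 2 * deriv (halfLogDeriv p) t * deriv p t - halfLogDeriv p t * deriv (deriv p) t) / p t := by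
  have hev := deriv_eventually_eq_halfLogDeriv hp ht
  have hp' : Differentiable ℂ (deriv p) := (hp.contDiff (n := 2)).differentiable_deriv_two
  have h2 : ∀ᶠ w in 𝓝 t, deriv (deriv p) w
      = -2 * (deriv (halfLogDeriv p) w * p w + halfLogDeriv p w * deriv p w) := by
    filter_upwards [hev.eventually_nhds] with w hw
    have h : deriv p =ᶠ[𝓝 w] fun w => -2 * (halfLogDeriv p w * p w) := hw.mono fun x hx => hx.2
    rw [h.deriv_eq]
    exact ((hw.self_of_nhds.1.hasDerivAt.mul (hp w).hasDerivAt).const_mul (-2)).deriv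
  have hr := hev.self_of_nhds.1
  have hr' := differentiableAt_deriv_of_eventually (hev.mono fun w hw => hw.1)
  have h3 := (((hr'.hasDerivAt.mul (hp t).hasDerivAt).add
    (hr.hasDerivAt.mul (hp' t).hasDerivAt)).const_mul (-2)).deriv
  have h4 : deriv (deriv (deriv p)) t = _ := (Filter.EventuallyEq.deriv_eq h2).trans h3
  have h2' := h2.self_of_nhds
  constructor
  · rw [eq_div_iff ht, h2']
    ring
  · rw [eq_div_iff ht, h4]
    ring

/-- Locally uniform convergence of holomorphic functions passes to derivatives; three of them
suffice by `deriv_halfLogDeriv`. -/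
theorem tendsto_halfLogDeriv {p : ℕ → ℂ → ℂ} {F : ℂ → ℂ} (hp : ∀ n, Differentiable ℂ (p n))
    (hF : TendstoLocallyUniformlyOn p F atTop univ) {t : ℂ} (ht : F t ≠ 0) :
    Tendsto (fun n => halfLogDeriv (p n) t) atTop (𝓝 (halfLogDeriv F t)) ∧
    Tendsto (fun n => deriv (halfLogDeriv (p n)) t) atTop (𝓝 (deriv (halfLogDeriv F) t)) ∧
    Tendsto (fun n => deriv (deriv (halfLogDeriv (p n))) t) atTop
      (𝓝 (deriv (deriv (halfLogDeriv F)) t)) := by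
  have hFd : Differentiable ℂ F := differentiableOn_univ.mp
    (hF.differentiableOn (Eventually.of_forall fun n => (hp n).differentiableOn) isOpen_univ)
  have hd : ∀ f : ℂ → ℂ, Differentiable ℂ f → Differentiable ℂ (deriv f) := fun f hf =>
    (hf.contDiff (n := 2)).differentiable_deriv_two
  have hF1 := hF.deriv (Eventually.of_forall fun n => (hp n).differentiableOn) isOpen_univ
  have hF2 := hF1.deriv (Eventually.of_forall fun n => (hd _ (hp n)).differentiableOn) isOpen_univ
  have hF3 := hF2.deriv (Eventually.of_forall fun n => (hd _ (hd _ (hp n))).differentiableOn)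
    isOpen_univ
  have t0 := hF.tendsto_at (mem_univ t)
  have t1 := hF1.tendsto_at (mem_univ t)
  have t2 := hF2.tendsto_at (mem_univ t)
  have t3 := hF3.tendsto_at (mem_univ t)
  simp only [Function.comp_apply] at t1 t2 t3
  have hne := t0.eventually_ne ht
  have l0 : Tendsto (fun n => halfLogDeriv (p n) t) atTop (𝓝 (halfLogDeriv F t)) :=
    t1.neg.div (t0.const_mul 2) (mul_ne_zero two_ne_zero ht)
  have l1 : Tendsto (fun n => deriv (halfLogDeriv (p n)) t) atTop
      (𝓝 (deriv (halfLogDeriv F) t)) := by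
    rw [(deriv_halfLogDeriv hFd ht).1]
    exact (((t2.neg.div_const 2).sub (l0.mul t1)).div t0 ht).congr'
      (hne.mono fun n hn => (deriv_halfLogDeriv (hp n) hn).1.symm)
  refine ⟨l0, l1, ?_⟩
  rw [(deriv_halfLogDeriv hFd ht).2]
  exact ((((t3.neg.div_const 2).sub ((l1.const_mul 2).mul t1)).sub (l0.mul t2)).div t0 ht).congr'
    (hne.mono fun n hn => (deriv_halfLogDeriv (hp n) hn).2.symm)

theorem tendsto_zero_of_sq {u : ℕ → ℂ} (h : Tendsto (fun n => u n ^ 2) atTop (𝓝 0)) :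
    Tendsto u atTop (𝓝 0) := by
  rw [tendsto_zero_iff_norm_tendsto_zero] at h ⊢
  have h2 := h.sqrt
  rw [Real.sqrt_zero] at h2
  refine h2.congr fun n => ?_
  rw [norm_pow, Real.sqrt_sq (norm_nonneg _)]

/-- The limit of the finite `n` differential equations. -/
theorem limit_equation {r r' r'' s s' η : ℕ → ℂ} {a a' a'' t : ℂ}
    (hη : Tendsto η atTop (𝓝 0)) (hr : Tendsto r atTop (𝓝 a)) (hr' : Tendsto r' atTop (𝓝 a'))
    (hr'' : Tendsto r'' atTop (𝓝 a''))
    (h1 : ∀ᶠ n in atTop, r' n = 2 * (s n * s n) - η n * (t * s n))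
    (h2 : ∀ᶠ n in atTop, r'' n = 4 * (s n * s' n) - η n * (s n + t * s' n))
    (h3 : ∀ᶠ n in atTop, (r n + t * (2 * (s n * s n) + η n * (t * s n))) ^ 2
      - (s n + t * s' n) ^ 2 = t * ((4 + 8 * (η n * (t * s n))) * (t * (s n * s n)))) :
    8 * a' * (a + t * a') ^ 2 - (2 * a' + t * a'') ^ 2 = 16 * t ^ 2 * a' ^ 2 := by
  -- Convergence of `s` is not assumed; only `r'` controls it. Completing the square in the first
  -- equation shows that η s tends to 0, hence that s² converges.
  have hu : Tendsto (fun n => η n * s n) atTop (𝓝 0) := by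
    have hx : Tendsto (fun n => η n * s n - η n ^ 2 * t / 4) atTop (𝓝 0) := by
      refine tendsto_zero_of_sq ?_
      have := ((hη.pow 2).mul (hr'.div_const 2)).add (((hη.pow 4).mul_const (t ^ 2)).div_const 16)
      simp only [ne_eq, OfNat.ofNat_ne_zero, not_false_eq_true, zero_pow, zero_mul, zero_div,
        add_zero] at this
      refine this.congr' (h1.mono fun n hn => ?_)
      rw [hn]
      ring
    have := hx.add (((hη.pow 2).mul_const t).div_const 4)
    simp only [ne_eq, OfNat.ofNat_ne_zero, not_false_eq_true, zero_pow, zero_mul, zero_div,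
      add_zero] at this
    exact this.congr fun n => by ring
  have hs : Tendsto (fun n => s n * s n) atTop (𝓝 (a' / 2)) := by
    have := (hr'.add (hu.mul_const t)).div_const 2
    rw [zero_mul, add_zero] at this
    refine this.congr' (h1.mono fun n hn => ?_)
    rw [hn]
    ring
  -- The multiplier is (4s - ηt)². The derivative `s'` is eliminated by (4s - ηt) s' = r'' + η s,
  -- leaving only s², η s, η, r and r'', all of which converge.
  have hL : Tendsto (fun n => (16 * (s n * s n) - 8 * (η n * s n) * t + (η n) ^ 2 * t ^ 2)
      * (r n + t * (2 * (s n * s n) + (η n * s n) * t)) ^ 2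
      - (4 * (s n * s n) - (η n * s n) * t + t * (r'' n + η n * s n)) ^ 2
      - (16 * (s n * s n) - 8 * (η n * s n) * t + (η n) ^ 2 * t ^ 2)
        * (t * ((4 + 8 * (η n * s n) * t) * (t * (s n * s n))))) atTop
      (𝓝 ((16 * (a' / 2) - 8 * 0 * t + 0 ^ 2 * t ^ 2) * (a + t * (2 * (a' / 2) + 0 * t)) ^ 2
      - (4 * (a' / 2) - 0 * t + t * (a'' + 0)) ^ 2
      - (16 * (a' / 2) - 8 * 0 * t + 0 ^ 2 * t ^ 2)
        * (t * ((4 + 8 * 0 * t) * (t * (a' / 2)))))) := by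
    have hq := ((hs.const_mul 16).sub ((hu.const_mul 8).mul_const t)).add
      ((hη.pow 2).mul_const (t ^ 2))
    exact ((hq.mul ((hr.add (((hs.const_mul 2).add (hu.mul_const t)).const_mul t)).pow 2)).sub
      ((((hs.const_mul 4).sub (hu.mul_const t)).add ((hr''.add hu).const_mul t)).pow 2)).sub
      (hq.mul (((((hu.const_mul 8).mul_const t).const_add 4).mul (hs.const_mul t)).const_mul t))
  have h0 : Tendsto (fun _ : ℕ => (0 : ℂ)) atTop (𝓝 _) := hL.congr' (by
    filter_upwards [h2, h3] with n hn2 hn3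
    rw [hn2]
    linear_combination (16 * (s n * s n) - 8 * (η n * s n) * t + (η n) ^ 2 * t ^ 2) * hn3)
  have := tendsto_nhds_unique h0 tendsto_const_nhds
  linear_combination this

theorem halfLogDeriv_limit_equation {F : ℂ → ℂ}
    (hF : TendstoLocallyUniformlyOn scaledDet F atTop univ) {t : ℂ} (ht : F t ≠ 0) :
    8 * deriv (halfLogDeriv F) t * (halfLogDeriv F t + t * deriv (halfLogDeriv F) t) ^ 2
      - (2 * deriv (halfLogDeriv F) t + t * deriv (deriv (halfLogDeriv F)) t) ^ 2
      = 16 * t ^ 2 * deriv (halfLogDeriv F) t ^ 2 := by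
  obtain ⟨l0, l1, l2⟩ := tendsto_halfLogDeriv differentiable_scaledDet hF ht
  have hne := (hF.tendsto_at (mem_univ t)).eventually_ne ht
  have heq : ∀ m, scaledDet m t ≠ 0 → halfLogDeriv (scaledDet m) =ᶠ[𝓝 t] scaledR m := fun m hm => by
    filter_upwards [eventually_scaledDet_ne_zero hm] with w hw
    rw [halfLogDeriv, (hasDerivAt_scaledDet hw).deriv]
    field_simp
  have heq1 : ∀ m, scaledDet m t ≠ 0 → deriv (halfLogDeriv (scaledDet m)) =ᶠ[𝓝 t]
      fun t => 2 * (scaledS m t * scaledS m t) - finiteSize m * (t * scaledS m t) := fun m hm => by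
    refine (heq m hm).deriv.trans ?_
    filter_upwards [eventually_scaledDet_ne_zero hm] with w hw
    exact (hasDerivAt_scaledR hw).deriv
  refine limit_equation (s := fun m => scaledS m t) (s' := fun m => deriv (scaledS m) t)
    tendsto_finiteSize l0 l1 l2 (hne.mono fun m hm => (heq1 m hm).self_of_nhds)
    (hne.mono fun m hm => ?_) (hne.mono fun m hm => ?_)
  · rw [(heq1 m hm).deriv_eq]
    have hS := (differentiableAt_scaledS hm).hasDerivAt
    refine ((((hS.mul hS).const_mul 2).sub
      (((hasDerivAt_id t).mul hS).const_mul (finiteSize m))).congr_deriv ?_).deriv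
    simp only [id_eq]
    ring
  · rw [(heq m hm).self_of_nhds]
    exact scaledS_deriv_relation hm

/-! ### The gap probability of the ensemble -/

theorem gueGapProb_eventuallyEq (n : ℕ) {a : ℝ} (ha : 0 < a) :
    (fun b : ℝ => gueGapProb b n) =ᶠ[𝓝 a] fun b : ℝ => (gapDet n b).re := by
  filter_upwards [lt_mem_nhds ha] with b hb
  rw [← ofReal_gueGapProb n hb.le, Complex.ofReal_re]

theorem hasDerivAt_gueGapProb (n : ℕ) {a : ℝ} (ha : 0 < a) :
    HasDerivAt (fun b : ℝ => gueGapProb b n) (deriv (gapDet n) a).re a :=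
  ((differentiable_gapDet n a).hasDerivAt.real_of_complex).congr_of_eventuallyEq
    (gueGapProb_eventuallyEq n ha)

/-- A holomorphic function that is real on a real neighbourhood has real derivatives there. -/
theorem ofReal_deriv_eq {f : ℂ → ℂ} {g : ℝ → ℝ} {x : ℝ} (hf : DifferentiableAt ℂ f x)
    (hfg : ∀ᶠ y : ℝ in 𝓝 x, f y = g y) :
    HasDerivAt g (deriv g x) x ∧ ((deriv g x : ℝ) : ℂ) = deriv f x := by
  have h1 : HasDerivAt g (deriv f x).re x := by
    refine hf.hasDerivAt.real_of_complex.congr_of_eventuallyEq (hfg.mono fun y hy => ?_)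
    simp only [hy, Complex.ofReal_re]
  have h2 := h1.ofReal_comp.unique
    (hf.hasDerivAt.comp_ofReal.congr_of_eventuallyEq (hfg.mono fun y hy => hy.symm))
  rw [h1.deriv]
  exact ⟨h1, h2⟩

theorem ofReal_gueSigma (n : ℕ) {a : ℝ} (ha : 0 < a) :
    (gueSigma n a : ℂ) = a * (deriv (gapDet n) a / gapDet n a) := by
  have h := ofReal_deriv_eq (g := fun b => gueGapProb b n) (differentiable_gapDet n a)
    ((lt_mem_nhds ha).mono fun b hb => (ofReal_gueGapProb n (le_of_lt hb)).symm)
  rw [gueSigma, (h.1.log (gueGapProb_pos n a).ne').deriv]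
  push_cast
  rw [h.2, ofReal_gueGapProb n ha.le]

/-- Since a = τ/(2√(2n)), the scaled variable √(2n) a is τ/2, and a d/da is invariant under scaling.
-/
theorem ofReal_gueSigma_scaled (m : ℕ) {τ : ℝ} (hτ : 0 < τ) :
    (gueSigma (m + 1) (τ / (2 * √(2 * ((m + 1 : ℕ) : ℝ)))) : ℂ)
      = -τ * halfLogDeriv (scaledDet m) (τ / 2) := by
  have hl := ladder_succ_ne_zero m
  have hpos : (0 : ℝ) < √(2 * ((m + 1 : ℕ) : ℝ)) := by positivity
  have ha : ((τ / (2 * √(2 * ((m + 1 : ℕ) : ℝ))) : ℝ) : ℂ) = τ / 2 / ladder (m + 1) := by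
    rw [ladder, div_div]
    push_cast
    rfl
  rw [ofReal_gueSigma _ (by positivity), ha, halfLogDeriv, scaledDet]
  have hd : deriv (scaledDet m) (τ / 2)
      = deriv (gapDet (m + 1)) (τ / 2 / ladder (m + 1)) / ladder (m + 1) :=
    (hasDerivAt_comp_div (differentiable_gapDet (m + 1) _).hasDerivAt).deriv
  have hne : gapDet (m + 1) (τ / 2 / ladder (m + 1)) ≠ 0 := by
    rw [← ha, ← ofReal_gueGapProb _ (by positivity)]
    exact Complex.ofReal_ne_zero.mpr (gueGapProb_pos _ _).ne'
  rw [hd]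
  field_simp

theorem scaledDet_ofReal (m : ℕ) {t : ℝ} (ht : 0 ≤ t) :
    scaledDet m t = (gueGapProb (t / √(2 * ((m + 1 : ℕ) : ℝ))) (m + 1) : ℂ) := by
  rw [ofReal_gueGapProb _ (by positivity), scaledDet, ladder]
  push_cast
  rfl

/-! ### The limiting gap probability -/

section Limit

variable {F : ℂ → ℂ} (hF : TendstoLocallyUniformlyOn scaledDet F atTop univ)
include hF

theorem differentiable_limit : Differentiable ℂ F := differentiableOn_univ.mp
  (hF.differentiableOn (Eventually.of_forall fun n => (differentiable_scaledDet n).differentiableOn)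
    isOpen_univ)

theorem limit_zero : F 0 = 1 := by
  have h := hF.tendsto_at (mem_univ 0)
  simp_rw [scaledDet_zero] at h
  exact tendsto_nhds_unique h tendsto_const_nhds

theorem tendsto_gueGapProb_scaled {t : ℝ} (ht : 0 ≤ t) :
    Tendsto (fun m : ℕ => gueGapProb (t / √(2 * ((m + 1 : ℕ) : ℝ))) (m + 1)) atTop
      (𝓝 (F t).re) ∧ (F t).im = 0 := by
  have h := hF.tendsto_at (mem_univ (t : ℂ))
  simp_rw [scaledDet_ofReal _ ht] at h
  have hre := (Complex.continuous_re.tendsto _).comp h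
  have him := (Complex.continuous_im.tendsto _).comp h
  exact ⟨hre, tendsto_nhds_unique him tendsto_const_nhds⟩

/-- F is real, nonnegative and nonincreasing on the half-line, so a zero at t would make F vanish on
[t, ∞), hence identically, against F(0) = 1. -/
theorem limit_ne_zero {t : ℝ} (ht : 0 < t) : F t ≠ 0 := fun h0 => by
  have hzero : ∀ s : ℝ, t ≤ s → F s = 0 := fun s hs => by
    have h1 := tendsto_gueGapProb_scaled hF ht.le
    have h2 := tendsto_gueGapProb_scaled hF (ht.le.trans hs)
    have hle : (F s).re ≤ (F t).re := le_of_tendsto_of_tendsto' h2.1 h1.1 fun m =>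
      gueGapProb_anti _ (by gcongr)
    have hge : 0 ≤ (F s).re := ge_of_tendsto' h2.1 fun m => (gueGapProb_pos _ _).le
    rw [h0, Complex.zero_re] at hle
    exact Complex.ext (le_antisymm hle hge) h2.2
  have han : AnalyticOnNhd ℂ F univ := fun z _ => (differentiable_limit hF).analyticAt z
  have hfreq : ∃ᶠ z in 𝓝[≠] ((t + 1 : ℝ) : ℂ), F z = 0 := by
    have hT : Tendsto (fun x : ℝ => (x : ℂ)) (𝓝[>] (t + 1)) (𝓝[≠] ((t + 1 : ℝ) : ℂ)) :=
      tendsto_nhdsWithin_of_tendsto_nhds_of_eventually_within _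
        ((Complex.continuous_ofReal.tendsto _).mono_left nhdsWithin_le_nhds)
        (eventually_mem_nhdsWithin.mono fun x hx h =>
          (ne_of_gt hx : x ≠ t + 1) (Complex.ofReal_injective h))
    refine hT.frequently (Eventually.frequently ?_)
    exact eventually_mem_nhdsWithin.mono fun x hx => hzero x (by
      have : t + 1 < x := hx
      linarith)
  have h := han.eqOn_zero_of_preconnected_of_frequently_eq_zero isPreconnected_univ
    (mem_univ _) hfreq (mem_univ 0)
  rw [limit_zero hF] at h
  exact one_ne_zero h

end Limit

/-! ### The limiting σ-function and its equation. -/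

/-- The limiting `σ`-function attached to the limit `F` of the scaled gap determinants. -/
noncomputable def sigmaOf (F : ℂ → ℂ) (τ : ℂ) : ℂ := -τ * halfLogDeriv F (τ / 2)

theorem hasDerivAt_sigmaOf {F : ℂ → ℂ} (hF : Differentiable ℂ F) {τ : ℂ} (hτ : F (τ / 2) ≠ 0) :
    HasDerivAt (sigmaOf F)
      (-(halfLogDeriv F (τ / 2) + τ / 2 * deriv (halfLogDeriv F) (τ / 2))) τ := by
  have h := (deriv_eventually_eq_halfLogDeriv hF hτ).self_of_nhds.1.hasDerivAt
  refine ((hasDerivAt_id τ).neg.mul (hasDerivAt_comp_div h)).congr_deriv ?_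
  simp only [Pi.neg_apply, id_eq]
  ring

theorem deriv_deriv_sigmaOf {F : ℂ → ℂ} (hF : Differentiable ℂ F) {τ : ℂ} (hτ : F (τ / 2) ≠ 0) :
    deriv (deriv (sigmaOf F)) τ
      = -(deriv (halfLogDeriv F) (τ / 2) + τ / 4 * deriv (deriv (halfLogDeriv F)) (τ / 2)) := by
  have hcont : ContinuousAt (fun τ : ℂ => F (τ / 2)) τ :=
    (hF.continuous.comp (continuous_id.div_const 2)).continuousAt
  have hev : deriv (sigmaOf F) =ᶠ[𝓝 τ] fun τ =>
      -(halfLogDeriv F (τ / 2) + τ / 2 * deriv (halfLogDeriv F) (τ / 2)) :=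
    (hcont.eventually_ne hτ).mono fun w hw => (hasDerivAt_sigmaOf hF hw).deriv
  have hev2 := deriv_eventually_eq_halfLogDeriv hF hτ
  have h := hev2.self_of_nhds.1.hasDerivAt
  have h' := (differentiableAt_deriv_of_eventually (hev2.mono fun w hw => hw.1)).hasDerivAt
  rw [hev.deriv_eq]
  refine (((hasDerivAt_comp_div h).add
    (((hasDerivAt_id τ).div_const 2).mul (hasDerivAt_comp_div h'))).neg.congr_deriv ?_).deriv
  simp only [id_eq]
  ring

theorem isOpen_ne_zero_half {F : ℂ → ℂ} (hF : Differentiable ℂ F) :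
    IsOpen {τ : ℂ | F (τ / 2) ≠ 0} :=
  isOpen_ne_fun (hF.continuous.comp (continuous_id.div_const 2)) continuous_const

theorem isJMMSSolution_sigmaOf {F : ℂ → ℂ}
    (hF : TendstoLocallyUniformlyOn scaledDet F atTop univ) :
    IsJMMSSolution {τ : ℂ | F (τ / 2) ≠ 0} (sigmaOf F) := by
  have hd := differentiable_limit hF
  refine ⟨DifferentiableOn.contDiffOn (fun τ hτ =>
    (hasDerivAt_sigmaOf hd hτ).differentiableAt.differentiableWithinAt) (isOpen_ne_zero_half hd),
    fun τ hτ => ?_⟩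
  have h := halfLogDeriv_limit_equation hF hτ
  rw [(hasDerivAt_sigmaOf hd hτ).deriv, deriv_deriv_sigmaOf hd hτ, sigmaOf]
  -- With t = τ/2 and R = `halfLogDeriv F` at t: σ' = -(R + tR'), σ - τσ' = 2t²R' and τσ'' = -t(2R'
  -- + tR'').
  linear_combination (-τ ^ 2 / 4) * h

theorem tendsto_gueSigma {F : ℂ → ℂ} (hF : TendstoLocallyUniformlyOn scaledDet F atTop univ)
    {τ : ℝ} (hτ : 0 < τ) :
    Tendsto (fun n : ℕ => gueSigma n (τ / (2 * √(2 * (n : ℝ))))) atTop (𝓝 (sigmaOf F τ).re) ∧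
      sigmaOf F τ = ((sigmaOf F τ).re : ℂ) := by
  have hne : F ((τ : ℂ) / 2) ≠ 0 := by
    have := limit_ne_zero hF (half_pos hτ)
    rwa [Complex.ofReal_div, Complex.ofReal_ofNat] at this
  have h := (tendsto_halfLogDeriv differentiable_scaledDet hF hne).1.const_mul (-(τ : ℂ))
  simp_rw [← ofReal_gueSigma_scaled _ hτ] at h
  have hre := (Complex.continuous_re.tendsto _).comp h
  have him := (Complex.continuous_im.tendsto _).comp h
  refine ⟨?_, Complex.ext rfl (tendsto_nhds_unique him tendsto_const_nhds)⟩
  rw [← tendsto_add_atTop_iff_nat 1]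
  exact hre

theorem IsJMMSSolution.mono {U V : Set ℂ} {f : ℂ → ℂ} (h : IsJMMSSolution V f) (hUV : U ⊆ V) :
    IsJMMSSolution U f :=
  ⟨h.1.mono hUV, fun τ hτ => h.2 τ (hUV hτ)⟩

/-- Where f is real on an open part of the real line, its complex derivatives there are those of its
real restriction, so the equation descends. -/
theorem IsJMMSSolution.re {V : Set ℂ} {f : ℂ → ℂ} (hV : IsOpen V) (h : IsJMMSSolution V f)
    {I : Set ℝ} (hI : IsOpen I) (hIV : ∀ x ∈ I, (x : ℂ) ∈ V ∧ f x = ((f x).re : ℂ)) :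
    IsJMMSSolution I fun x : ℝ => (f x).re := by
  have hd : ∀ x ∈ V, DifferentiableAt ℂ f x := fun x hx =>
    (h.1.contDiffAt (hV.mem_nhds hx)).differentiableAt (by norm_num)
  have h1 : ∀ x ∈ I, ((deriv (fun x : ℝ => (f x).re) x : ℝ) : ℂ) = deriv f x := fun x hx =>
    (ofReal_deriv_eq (hd x (hIV x hx).1)
      ((hI.eventually_mem hx).mono fun y hy => (hIV y hy).2)).2
  have h2 : ∀ x ∈ I, ((deriv (deriv fun x : ℝ => (f x).re) x : ℝ) : ℂ) = deriv (deriv f) x :=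
    fun x hx => (ofReal_deriv_eq (differentiableAt_deriv_of_eventually
      ((hV.eventually_mem (hIV x hx).1).mono hd))
      ((hI.eventually_mem hx).mono fun y hy => (h1 y hy).symm)).2
  refine ⟨fun x hx => (ContDiffAt.real_of_complex
    (h.1.contDiffAt (hV.mem_nhds (hIV x hx).1))).contDiffWithinAt, fun x hx => ?_⟩
  have h3 := h.2 x (hIV x hx).1
  rw [← h2 x hx, ← h1 x hx, (hIV x hx).2] at h3
  exact_mod_cast h3

/-! ### The change of variables -/

/-- With zero parameters the right side factors as (s - ts')(s - ts' + 4s'²). For s(t) = f(ct) with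
c² = -1/4 one has ts' = τf', 4s'² = -f'² and (ts'')² = -(τf'')²/4, where τ = ct. -/
theorem isJMMSSolution_iff_isSigmaPVSolution (U : Set ℂ) (f : ℂ → ℂ) :
    IsJMMSSolution U f ↔
      IsSigmaPVSolution (fun _ : Fin 4 => (0 : ℂ)) {t : ℂ | Complex.I / 2 * t ∈ U}
        (fun t : ℂ => f (Complex.I / 2 * t)) := by
  obtain ⟨c, hc⟩ : ∃ c : ℂ, c = Complex.I / 2 := ⟨_, rfl⟩
  rw [← hc]
  have hc0 : c ≠ 0 := by simp [hc]
  have hc2 : c ^ 2 = -1 / 4 := by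
    rw [hc, div_pow, Complex.I_sq]
    norm_num
  have h1 : deriv (fun t => f (c * t)) = fun t => c * deriv f (c * t) := by
    ext t
    rw [deriv_comp_mul_left, smul_eq_mul]
  have h2 : deriv (deriv fun t => f (c * t)) = fun t => c * (c * deriv (deriv f) (c * t)) := by
    ext t
    rw [h1, deriv_const_mul_field, deriv_comp_mul_left, smul_eq_mul]
  have hcd : ContDiffOn ℂ 2 f U ↔ ContDiffOn ℂ 2 (fun t => f (c * t)) {t : ℂ | c * t ∈ U} := by
    constructor
    · intro h
      exact h.comp (contDiff_const.mul contDiff_id).contDiffOn fun t ht => ht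
    · intro h
      have h3 : ContDiffOn ℂ 2 ((fun t => f (c * t)) ∘ fun t => c⁻¹ * t) U :=
        h.comp (contDiff_const.mul contDiff_id).contDiffOn fun t ht => by
          change c * (c⁻¹ * t) ∈ U
          rwa [mul_inv_cancel_left₀ hc0]
      refine h3.congr fun t _ => ?_
      rw [Function.comp_apply, mul_inv_cancel_left₀ hc0]
  have heq : ∀ t : ℂ, ((c * t * deriv (deriv f) (c * t)) ^ 2 =
      -4 * (f (c * t) - c * t * deriv f (c * t) - deriv f (c * t) ^ 2)
        * (f (c * t) - c * t * deriv f (c * t))) ↔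
      (t * deriv (deriv fun t => f (c * t)) t) ^ 2 =
      (f (c * t) - t * deriv (fun t => f (c * t)) t + 2 * deriv (fun t => f (c * t)) t ^ 2
        + (∑ _i : Fin 4, (0 : ℂ)) * deriv (fun t => f (c * t)) t) ^ 2
        - 4 * ∏ _i : Fin 4, ((0 : ℂ) + deriv (fun t => f (c * t)) t) := fun t => by
    rw [h2, h1]
    simp only [Finset.sum_const_zero, zero_add, Finset.prod_const, Finset.card_univ,
      Fintype.card_fin, zero_mul, add_zero]
    constructor
    · intro h
      linear_combination c ^ 2 * h - 4 * (f (c * t) - c * t * deriv f (c * t)) ^ 2 * hc2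
    · intro h
      linear_combination -4 * h + 4 * ((c * t * deriv (deriv f) (c * t)) ^ 2
        - 4 * deriv f (c * t) ^ 2 * (f (c * t) - c * t * deriv f (c * t))) * hc2
  constructor
  · rintro ⟨ha, hb⟩
    exact ⟨hcd.mp ha, fun t ht => (heq t).mp (hb (c * t) ht)⟩
  · rintro ⟨ha, hb⟩
    refine ⟨hcd.mpr ha, fun τ hτ => ?_⟩
    have h3 := (heq (c⁻¹ * τ)).mpr (hb (c⁻¹ * τ) (by
      change c * (c⁻¹ * τ) ∈ U
      rwa [mul_inv_cancel_left₀ hc0]))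
    rwa [mul_inv_cancel_left₀ hc0] at h3

theorem mainTheorem9 :
    -- the gap probability is positive and differentiable, so that `σ_n` is well defined
    (∀ (n : ℕ) (a : ℝ), 0 < a →
      0 < gueGapProb a n ∧ DifferentiableAt ℝ (fun b : ℝ => gueGapProb b n) a) ∧
    -- the limit `σ` exists on `(0, ∞)` and satisfies the equation
    (∃ σ : ℝ → ℝ,
      (∀ τ : ℝ, 0 < τ →
        Tendsto (fun n : ℕ => gueSigma n (τ / (2 * Real.sqrt (2 * (n : ℝ))))) atTop (𝓝 (σ τ))) ∧
      IsJMMSSolution (Ioi (0 : ℝ)) σ ∧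
      -- `σ` continues holomorphically to a connected open `U ⊆ ℂ` containing `(0, ∞)`, and
      -- `t ↦ σ (i t / 2)` satisfies the `σ`-form of Painlevé V with all parameters zero
      ∃ (U : Set ℂ) (F : ℂ → ℂ), IsOpen U ∧ IsConnected U ∧
        (∀ τ : ℝ, 0 < τ → (τ : ℂ) ∈ U ∧ F (τ : ℂ) = (σ τ : ℂ)) ∧
        IsJMMSSolution U F ∧
        IsSigmaPVSolution (fun _ : Fin 4 => (0 : ℂ)) {t : ℂ | Complex.I / 2 * t ∈ U}
          (fun t : ℂ => F (Complex.I / 2 * t))) ∧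
    -- the substitution converts one equation into the other
    (∀ (U : Set ℂ) (f : ℂ → ℂ), IsOpen U →
      (IsJMMSSolution U f ↔
        IsSigmaPVSolution (fun _ : Fin 4 => (0 : ℂ)) {t : ℂ | Complex.I / 2 * t ∈ U}
          (fun t : ℂ => f (Complex.I / 2 * t)))) := by
  refine ⟨fun n a ha => ⟨gueGapProb_pos n a, (hasDerivAt_gueGapProb n ha).differentiableAt⟩, ?_,
    fun U f _ => isJMMSSolution_iff_isSigmaPVSolution U f⟩
  obtain ⟨F, hF⟩ := exists_tendstoLocallyUniformlyOn_scaledDet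
  have hd := differentiable_limit hF
  set V : Set ℂ := {τ : ℂ | F (τ / 2) ≠ 0} with hV
  have hVo : IsOpen V := isOpen_ne_zero_half hd
  have hpos : ∀ τ : ℝ, 0 < τ → (τ : ℂ) ∈ V := fun τ hτ => by
    have := limit_ne_zero hF (half_pos hτ)
    rwa [Complex.ofReal_div, Complex.ofReal_ofNat] at this
  have hsol := isJMMSSolution_sigmaOf hF
  -- The domain is the component of 1 in the set where F(τ/2) ≠ 0; it contains the half-line, which
  -- is connected and lies in that set.
  have hsub : connectedComponentIn V 1 ⊆ V := connectedComponentIn_subset V 1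
  have h1V : (1 : ℂ) ∈ V := by simpa using hpos 1 one_pos
  have hray : (fun x : ℝ => (x : ℂ)) '' Ioi 0 ⊆ connectedComponentIn V 1 := by
    refine IsPreconnected.subset_connectedComponentIn
      (isPreconnected_Ioi.image _ Complex.continuous_ofReal.continuousOn) ⟨1, by simp, by simp⟩ ?_
    rintro _ ⟨x, hx, rfl⟩
    exact hpos x hx
  refine ⟨fun τ => (sigmaOf F τ).re, fun τ hτ => (tendsto_gueSigma hF hτ).1,
    hsol.re hVo isOpen_Ioi fun x hx => ⟨hpos x hx, (tendsto_gueSigma hF hx).2⟩,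
    connectedComponentIn V 1, sigmaOf F, hVo.connectedComponentIn,
    isConnected_connectedComponentIn_iff.mpr h1V,
    fun τ hτ => ⟨hray ⟨τ, hτ, rfl⟩, (tendsto_gueSigma hF hτ).2⟩, hsol.mono hsub, ?_⟩
  exact (isJMMSSolution_iff_isSigmaPVSolution _ _).mp (hsol.mono hsub)
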